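/- Setting. Let $\mathcal T$ be a locally compact, complete, separable metric space with a Radon measure $m$ on its Borel sets. An indexing collection is a class $\mathcal A$ of compact connected subsets of $\mathcal T$ with $\emptyset\in\mathcal A$, $U^\circ\ne U$ for $U\in\mathcal A\setminus\{\emptyset,\mathcal T\}$, closed under arbitrary intersections, such that $U\cap V\neq\emptyset$ for nonempty $U,V\in\mathcal A$, $\overline{\bigcup_iU_i}\in\mathcal A$ for increasing sequences $(U_i)$ in $\mathcal A$, and $\sigma(\mathcal A)$ is the Borel $\sigma$-algebra; together with an increasing sequence of finite subclasses $\mathcal A_n\subseteq\mathcal A$, closed under intersections, containing $\emptyset$ and at least one nonempty set, such that $g_n(U)=\bigcap\{V\in\mathcal A_n: U\subseteq V^\circ\}$ belongs to $\mathcal A_n$ and $\bigcap_n g_n(U)=U$ for every $U\in\mathcal A$. Let $k_n=\#\mathcal A_n$ and assume admissibility: $\sum_n k_{n+1}k_n^{-1-\delta}<\infty$ for all $\delta>0$. Put $d_m(U,V)=m(U\triangle V)$ and $\emptyset'=\bigcap\{U\in\mathcal A:U\neq\emptyset\}$. For a (pseudo-)distance $d$ on $\mathcal A$ with open balls $B(U_0,\rho)$,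 the pointwise and local Hölder exponents of $f:\mathcal A\to\mathbf R$ at $U_0$ are $$\boldsymbol\alpha_f(U_0)=\sup\Big\{\alpha:\limsup_{\rho\to0}\sup_{U,V\in B(U_0,\rho)}\frac{|f(U)-f(V)|}{\rho^\alpha}<\infty\Big\},\qquad \widetilde{\boldsymbol\alpha}_f(U_0)=\sup\Big\{\alpha:\limsup_{\rho\to0}\sup_{U,V\in B(U_0,\rho)}\frac{|f(U)-f(V)|}{d(U,V)^\alpha}<\infty\Big\}$$ (with $0/0=0$ and $x/0=\infty$ for $x>0$). For $H\in(0,1/2]$, a set-indexed fractional Brownian motion on $(\mathcal T,\mathcal A,m)$ is a centered Gaussian process $\mathbf B^H=\{\mathbf B^H_U;U\in\mathcal A\}$ with $$\mathbf E[\mathbf B^H_U\mathbf B^H_V]=\tfrac12\big[m(U)^{2H}+m(V)^{2H}-m(U\triangle V)^{2H}\big].$$ All processes are assumed to be separable in the sense of Doob for the topology induced by $d_m$. Theorem. Let $H\in(0,1/2]$. (1) Let $\mathbf B^H$ be a set-indexed fractional Brownian motion on $(\mathcal T,\mathcal A,m)$. Assume that there are $q,M_1>0$ with $$\sup_{U\in\mathcal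 A}d_m(U,g_n(U))\le M_1k_n^{-1/q}\qquad\text{for all } n,$$ and that $m(\mathcal T\setminus\emptyset')>0$. Let the Hölder exponents be defined with respect to $d_m$ or to any (pseudo-)distance $d$ with $c\,d_m\le d\le C\,d_m$ on $\mathcal A$ for some constants $c,C>0$. Then $$\mathbf P\big(\forall U_0\in\mathcal A,\ \widetilde{\boldsymbol\alpha}_{\mathbf B^H}(U_0)=H\big)=1,$$ where, if $m(\emptyset')>0$, the set $U_0=\emptyset$ (which is then an isolated point) is excluded. If, in addition, there exists $\eta>0$ such that for every $U_0\in\mathcal A$ there is $\rho_0>0$ with $$\inf_{0<\rho<\rho_0}\ \sup\Big\{\frac{d_m(U,g_n(U))}{\rho};\ n\in\mathbf N,\ U\in\mathcal A,\ U,g_n(U)\in B_{d_m}(U_0,\rho)\Big\}\ge\eta,$$ then $\mathbf P\big(\forall U_0\in\mathcal A,\ \boldsymbol\alpha_{\mathbf B^H}(U_0)=H\big)=1.$ (2) Let $N\ge1$, let $\mathcal A=\{[0,t];t\in\mathbf R_+^N\}\cup\{\emptyset\}$ with Lebesgue measure $\lambda$, and let $\mathbf B^H$ be a multiparameter fractional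 Brownian motion, i.e. satisfy the covariance formula above with $m=\lambda$. Then, with respect to $d_\lambda$ or any equivalent distance as in (1), $$\mathbf P\big(\forall U_0\in\mathcal A \text{ with } \lambda(U_0)>0,\ \boldsymbol\alpha_{\mathbf B^H}(U_0)=\widetilde{\boldsymbol\alpha}_{\mathbf B^H}(U_0)=H\big)=1,$$ and for $N=1$ the same holds with all $U_0\in\mathcal A$. For every $N\geq 1$ and every $b\in\mathbf R_+^N$ with positive coordinates, the same holds with all $U_0\in\mathcal A$ when $\mathcal A$ is replaced by $\{[0,t];0\le t\le b\}\cup\{\emptyset\}$. -/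

import Mathlib

open MeasureTheory ProbabilityTheory Filter Topology
open scoped ENNReal symmDiff

noncomputable section

namespace SetIndexed

/-! ### Hölder exponents of a function on a set with a (pseudo-)distance -/

section Exponents

variable {ι : Type*}

/-- `d` is a pseudo-distance on `ι`. -/
structure IsPseudoDist (d : ι → ι → ℝ) : Prop where
  nonneg : ∀ i j, 0 ≤ d i j
  self : ∀ i, d i i = 0
  symm : ∀ i j, d i j = d j i
  triangle : ∀ i j k, d i k ≤ d i j + d j k

/-- Two (pseudo-)distances are equivalent: each is bounded by a constant multiple of the other. -/
def EquivalentDist (d d' : ι → ι → ℝ) : Prop :=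
  ∃ c C : ℝ, 0 < c ∧ 0 < C ∧ ∀ i j, c * d' i j ≤ d i j ∧ d i j ≤ C * d' i j

/-- The open ball `B_d(i₀, ρ)`. -/
def openBall (d : ι → ι → ℝ) (i₀ : ι) (ρ : ℝ) : Set ι := {i | d i₀ i < ρ}

/-- Open sets of the topology induced by `d`. -/
def IsOpenFor (d : ι → ι → ℝ) (O : Set ι) : Prop :=
  ∀ i ∈ O, ∃ ρ : ℝ, 0 < ρ ∧ openBall d i ρ ⊆ O

/-- Pointwise Hölder exponent of `f` at `i₀`: the supremum of the `α` such that
`limsup_{ρ → 0+} sup_{i, j ∈ B(i₀, ρ)} |f i - f j| / ρ ^ α < ∞`. -/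
def pointwiseHolderExponent (d : ι → ι → ℝ) (f : ι → ℝ) (i₀ : ι) : EReal :=
  ⨆ (α : ℝ) (_ : limsup (fun ρ : ℝ => ⨆ i ∈ openBall d i₀ ρ, ⨆ j ∈ openBall d i₀ ρ,
      ENNReal.ofReal |f i - f j| / ENNReal.ofReal ρ ^ α) (𝓝[>] 0) < ⊤), (α : EReal)

/-- Local Hölder exponent of `f` at `i₀`: the supremum of the `α` such that
`limsup_{ρ → 0+} sup_{i, j ∈ B(i₀, ρ)} |f i - f j| / d(i, j) ^ α < ∞`.
The quotient is taken in `[0, ∞]`: for `α > 0` and `d(i, j) = 0` it is `0` if `f i = f j`,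
and `∞` otherwise. -/
def localHolderExponent (d : ι → ι → ℝ) (f : ι → ℝ) (i₀ : ι) : EReal :=
  ⨆ (α : ℝ) (_ : limsup (fun ρ : ℝ => ⨆ i ∈ openBall d i₀ ρ, ⨆ j ∈ openBall d i₀ ρ,
      ENNReal.ofReal |f i - f j| / ENNReal.ofReal (d i j) ^ α) (𝓝[>] 0) < ⊤), (α : EReal)

/-- Doob separability of the real process `X` for the topology induced by `d`. -/
def IsSeparableProcess {Ω : Type*} [MeasurableSpace Ω] (d : ι → ι → ℝ) (X : ι → Ω → ℝ)
    (P : Measure Ω) : Prop :=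
  ∃ (S : Set ι) (Λ : Set Ω), S.Countable ∧ P Λ = 0 ∧
    ∀ (F : Set ℝ) (O : Set ι), IsClosed F → IsOpenFor d O →
      {ω | ∀ i ∈ O ∩ S, X i ω ∈ F} \ {ω | ∀ i ∈ O, X i ω ∈ F} ⊆ Λ

end Exponents

/-! ### Indexing collections -/

section Indexing

variable {T : Type*}

/-- `g_n(U)`, the intersection of the members of `𝒜ₙ` whose interior contains `U`. -/
def outerApprox [TopologicalSpace T] (𝒜n : Set (Set T)) (U : Set T) : Set T :=
  ⋂₀ {V | V ∈ 𝒜n ∧ U ⊆ interior V}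

/-- `𝒜` is an indexing collection on `T`, and `𝒜n 0 ⊆ 𝒜n 1 ⊆ …` are finite subclasses that
separate it from above. -/
structure IsIndexingCollection [TopologicalSpace T] (𝒜 : Set (Set T))
    (𝒜n : ℕ → Set (Set T)) : Prop where
  isCompact : ∀ U ∈ 𝒜, IsCompact U
  /-- connectedness; the empty set is allowed -/
  isPreconnected : ∀ U ∈ 𝒜, IsPreconnected U
  empty_mem : ∅ ∈ 𝒜
  interior_ne : ∀ U ∈ 𝒜, U ≠ ∅ → U ≠ Set.univ → interior U ≠ U
  sInter_mem : ∀ 𝒮 : Set (Set T), 𝒮 ⊆ 𝒜 → 𝒮.Nonempty → ⋂₀ 𝒮 ∈ 𝒜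
  inter_nonempty : ∀ U ∈ 𝒜, ∀ V ∈ 𝒜, U.Nonempty → V.Nonempty → (U ∩ V).Nonempty
  closure_iUnion_mem : ∀ U : ℕ → Set T, (∀ i, U i ∈ 𝒜) → Monotone U → closure (⋃ i, U i) ∈ 𝒜
  generateFrom_eq : MeasurableSpace.generateFrom 𝒜 = borel T
  sub_mono : Monotone 𝒜n
  sub_finite : ∀ n, (𝒜n n).Finite
  sub_subset : ∀ n, 𝒜n n ⊆ 𝒜
  sub_empty_mem : ∀ n, ∅ ∈ 𝒜n n
  sub_nonempty_mem : ∀ n, ∃ U ∈ 𝒜n n, U.Nonempty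
  sub_inter_mem : ∀ n, ∀ U ∈ 𝒜n n, ∀ V ∈ 𝒜n n, U ∩ V ∈ 𝒜n n
  outerApprox_mem : ∀ n, ∀ U ∈ 𝒜, outerApprox (𝒜n n) U ∈ 𝒜n n
  iInter_outerApprox : ∀ U ∈ 𝒜, ⋂ n, outerApprox (𝒜n n) U = U

/-- Admissibility of the cardinals `k_n = #𝒜ₙ`:
`∑ k_{n+1} / k_n ^ (1 + δ) < ∞` for every `δ > 0`. -/
def IsAdmissible (𝒜n : ℕ → Set (Set T)) : Prop :=
  ∀ δ : ℝ, 0 < δ →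
    Summable fun n : ℕ => ((𝒜n (n + 1)).ncard : ℝ) / ((𝒜n n).ncard : ℝ) ^ (1 + δ)

variable [MeasurableSpace T]

/-- `d_m(U, V) = m(U ∆ V)`. -/
def measDist (m : Measure T) (U V : Set T) : ℝ := m.real (U ∆ V)

/-- `d_m` on the collection `𝒜`. -/
def measDistOn (m : Measure T) (𝒜 : Set (Set T)) : 𝒜 → 𝒜 → ℝ :=
  fun U V => measDist m (U : Set T) (V : Set T)

/-- Existence of a discretization exponent `q` of `(𝒜ₙ)` for `d_m`:
`d_m(U, g_n(U)) ≤ M₁ k_n ^ (-1/q)` for all `n` and all `U ∈ 𝒜`. -/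
def HasDiscretizationExponent [TopologicalSpace T] (m : Measure T) (𝒜 : Set (Set T))
    (𝒜n : ℕ → Set (Set T)) : Prop :=
  ∃ q M₁ : ℝ, 0 < q ∧ 0 < M₁ ∧ ∀ n, ∀ U ∈ 𝒜,
    measDist m U (outerApprox (𝒜n n) U) ≤ M₁ * ((𝒜n n).ncard : ℝ) ^ (-1 / q)

/-- There is `η > 0` such that for every `U₀ ∈ 𝒜`, on some interval `(0, ρ₀)`,
`inf_ρ sup {d_m(U, g_n(U)) / ρ : n ∈ ℕ, U, g_n(U) ∈ B(U₀, ρ)} ≥ η`. -/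
def HasLargeIncrements [TopologicalSpace T] (m : Measure T) (𝒜 : Set (Set T))
    (𝒜n : ℕ → Set (Set T)) : Prop :=
  ∃ η : ℝ, 0 < η ∧ ∀ U₀ ∈ 𝒜, ∃ ρ₀ : ℝ, 0 < ρ₀ ∧
    ENNReal.ofReal η ≤ ⨅ ρ ∈ Set.Ioo 0 ρ₀, ⨆ (n : ℕ) (U ∈ 𝒜) (_ : measDist m U₀ U < ρ)
      (_ : measDist m U₀ (outerApprox (𝒜n n) U) < ρ),
        ENNReal.ofReal (measDist m U (outerApprox (𝒜n n) U) / ρ)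

/-- `X` is a set-indexed fractional Brownian motion of index `H` on `(T, 𝒜, m)`. -/
structure IsSIfBm {Ω : Type*} [MeasurableSpace Ω] (m : Measure T) (𝒜 : Set (Set T)) (H : ℝ)
    (X : 𝒜 → Ω → ℝ) (P : Measure Ω) : Prop where
  isGaussian : IsGaussianProcess X P
  centered : ∀ U, ∫ ω, X U ω ∂P = 0
  covariance : ∀ U V : 𝒜, ∫ ω, X U ω * X V ω ∂P =
    1 / 2 * (m.real (U : Set T) ^ (2 * H) + m.real (V : Set T) ^ (2 * H)
      - m.real ((U : Set T) ∆ (V : Set T)) ^ (2 * H))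

end Indexing

/-- The rectangles `[0, t]`, `t ∈ ℝ₊ᴺ`, together with the empty set. -/
def rectangles (N : ℕ) : Set (Set (Fin N → ℝ)) :=
  {U | U = ∅ ∨ ∃ t : Fin N → ℝ, 0 ≤ t ∧ U = Set.Icc 0 t}

/-- The rectangles `[0, t]`, `0 ≤ t ≤ b`, together with the empty set. -/
def rectanglesIn {N : ℕ} (b : Fin N → ℝ) : Set (Set (Fin N → ℝ)) :=
  {U | U = ∅ ∨ ∃ t : Fin N → ℝ, 0 ≤ t ∧ t ≤ b ∧ U = Set.Icc 0 t}

end SetIndexed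

end

/-! Set indexing enters only through the pseudo-distance `d_m`: the covariance gives increments of
variance `d_m(U, V) ^ (2H)`, so the probabilistic part is carried out for an abstract
`IsFractionalField` over a pseudo-metric space. An exponent equals `H` once the Hölder condition
holds below `H` and fails above it; testing two sequences of exponents tending to `H` keeps the
exceptional sets countable in number.

Below `H`, if polynomially many balls of radius `ε` cover the index set, Gaussian tails and chaining
along dyadic nets give Hölder continuity on a countable separating set, and separability extends it
to all points (`ae_forall_locHolderAt`).

Above `H`, the failure must hold at all points simultaneously. For the local exponent, countably
many balls suffice, since one sequence of shrinking pairs in a ball destroys the Hölder bound on the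
whole ball (`ae_forall_not_locHolderAt`). For the pointwise exponent, each point of a fine net is
given `K` pairs at geometrically separated scales. As `H ≤ 1/2`, `x ↦ x ^ (2H)` is subadditive, so
the covariance of two increments is at most the variance of the smaller one, and the normalized
increments are nearly orthogonal. A small-ball estimate (`measureReal_forall_abs_le`) bounds the
probability that all `K` are too small by a `K`-th power, which beats the polynomial size of the
net; Borel–Cantelli concludes (`ae_forall_not_ptHolderAt`).

It remains to check the geometry. Admissibility and the discretization exponent give polynomial
covering (`polyCovering_univ`), connectedness rules out isolated points (`exists_iterate_eq`), and
rectangles are handled by grids and by shrinking boxes. -/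

namespace SetIndexed

/-! ### Real-valued reformulation of the Hölder exponents -/

section HolderAt

variable {ι : Type*} {d d' : ι → ι → ℝ} {f : ι → ℝ} {i₀ : ι} {α β H : ℝ}

/-- `f` is `α`-Hölder on some ball around `i₀`. -/
def LocHolderAt (d : ι → ι → ℝ) (f : ι → ℝ) (i₀ : ι) (α : ℝ) : Prop :=
  ∃ r : ℝ, 0 < r ∧ ∃ M : ℝ, 0 ≤ M ∧ ∀ i ∈ openBall d i₀ r, ∀ j ∈ openBall d i₀ r,
    |f i - f j| ≤ M * d i j ^ α

/-- The oscillation of `f` on small balls of radius `ρ` around `i₀` is `O(ρ ^ α)`. -/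
def PtHolderAt (d : ι → ι → ℝ) (f : ι → ℝ) (i₀ : ι) (α : ℝ) : Prop :=
  ∃ r : ℝ, 0 < r ∧ ∃ M : ℝ, 0 ≤ M ∧ ∀ ρ : ℝ, 0 < ρ → ρ < r →
    ∀ i ∈ openBall d i₀ ρ, ∀ j ∈ openBall d i₀ ρ, |f i - f j| ≤ M * ρ ^ α

/-- For `α > 0` the conventions `0/0 = 0` and `x/0 = ∞` say exactly what the real inequality says at
`y = 0`. -/
lemma ofReal_div_rpow_le_iff {x y M : ℝ} (hx : 0 ≤ x) (hy : 0 ≤ y) (hM : 0 ≤ M) (hα : 0 < α) :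
    ENNReal.ofReal x / ENNReal.ofReal y ^ α ≤ ENNReal.ofReal M ↔ x ≤ M * y ^ α := by
  rw [ENNReal.ofReal_rpow_of_nonneg hy hα.le]
  rcases hy.eq_or_lt with rfl | hy
  · rw [Real.zero_rpow hα.ne']
    rcases hx.eq_or_lt with rfl | hx
    · simp
    · simp [ENNReal.div_zero, hx.not_ge]
  · have hp : 0 < y ^ α := Real.rpow_pos_of_pos hy _
    rw [← ENNReal.ofReal_div_of_pos hp, ENNReal.ofReal_le_ofReal_iff hM, div_le_iff₀ hp]

/-- The inner supremum decreases with the radius, so a bound at one radius suffices. -/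
lemma limsup_local_lt_top_iff (hd : IsPseudoDist d) (hα : 0 < α) :
    limsup (fun ρ : ℝ => ⨆ i ∈ openBall d i₀ ρ, ⨆ j ∈ openBall d i₀ ρ,
      ENNReal.ofReal |f i - f j| / ENNReal.ofReal (d i j) ^ α) (𝓝[>] 0) < ⊤ ↔
      LocHolderAt d f i₀ α := by
  constructor
  · intro h
    obtain ⟨b, hb, hbt⟩ := exists_between h
    have h2 := Filter.eventually_lt_of_limsup_lt hb
    obtain ⟨r, hr, h3⟩ := mem_nhdsGT_iff_exists_Ioo_subset.1 h2
    have hr : (0 : ℝ) < r := hr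
    have h4 := le_of_lt (Set.mem_ofPred_eq.mp (h3 ⟨half_pos hr, half_lt_self hr⟩))
    refine ⟨r / 2, half_pos hr, b.toReal, ENNReal.toReal_nonneg, fun i hi j hj => ?_⟩
    rw [← ofReal_div_rpow_le_iff (abs_nonneg _) (hd.nonneg i j) ENNReal.toReal_nonneg hα,
      ENNReal.ofReal_toReal hbt.ne]
    simp only [iSup_le_iff] at h4
    exact h4 i hi j hj
  · rintro ⟨r, hr, M, hM, h⟩
    refine lt_of_le_of_lt (limsup_le_of_le (a := ENNReal.ofReal M) (by isBoundedDefault) ?_)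
      ENNReal.ofReal_lt_top
    filter_upwards [Ioo_mem_nhdsGT hr] with ρ hρ
    simp only [iSup_le_iff]
    intro i hi j hj
    rw [ofReal_div_rpow_le_iff (abs_nonneg _) (hd.nonneg i j) hM hα]
    exact h i (lt_trans hi hρ.2) j (lt_trans hj hρ.2)

/-- The denominator now varies with the radius, so monotonicity is lost and the bound must be kept
for every small `ρ`. -/
lemma limsup_pointwise_lt_top_iff (hα : 0 < α) :
    limsup (fun ρ : ℝ => ⨆ i ∈ openBall d i₀ ρ, ⨆ j ∈ openBall d i₀ ρ,
      ENNReal.ofReal |f i - f j| / ENNReal.ofReal ρ ^ α) (𝓝[>] 0) < ⊤ ↔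
      PtHolderAt d f i₀ α := by
  constructor
  · intro h
    obtain ⟨b, hb, hbt⟩ := exists_between h
    have h2 := Filter.eventually_lt_of_limsup_lt hb
    obtain ⟨r, hr, h3⟩ := mem_nhdsGT_iff_exists_Ioo_subset.1 h2
    refine ⟨r, hr, b.toReal, ENNReal.toReal_nonneg, fun ρ hρ hρr i hi j hj => ?_⟩
    have h4 := le_of_lt (Set.mem_ofPred_eq.mp (h3 ⟨hρ, hρr⟩))
    rw [← ofReal_div_rpow_le_iff (abs_nonneg _) hρ.le ENNReal.toReal_nonneg hα,
      ENNReal.ofReal_toReal hbt.ne]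
    simp only [iSup_le_iff] at h4
    exact h4 i hi j hj
  · rintro ⟨r, hr, M, hM, h⟩
    refine lt_of_le_of_lt (limsup_le_of_le (a := ENNReal.ofReal M) (by isBoundedDefault) ?_)
      ENNReal.ofReal_lt_top
    filter_upwards [Ioo_mem_nhdsGT hr] with ρ hρ
    simp only [iSup_le_iff]
    intro i hi j hj
    rw [ofReal_div_rpow_le_iff (abs_nonneg _) hρ.1.le hM hα]
    exact h ρ hρ.1 hρ.2 i hi j hj

lemma LocHolderAt.mono_exponent (hd : IsPseudoDist d) (hβ : 0 < β) (hβα : β ≤ α)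
    (h : LocHolderAt d f i₀ α) : LocHolderAt d f i₀ β := by
  obtain ⟨r, hr, M, hM, h⟩ := h
  -- Radius at most `1/2` keeps mutual distances at most `1`, where lowering the exponent increases
  -- the power.
  refine ⟨min r (1 / 2), by positivity, M, hM, fun i hi j hj => ?_⟩
  have hi1 : d i₀ i < r := lt_of_lt_of_le hi (min_le_left _ _)
  have hi2 : d i₀ i < 1 / 2 := lt_of_lt_of_le hi (min_le_right _ _)
  have hj1 : d i₀ j < r := lt_of_lt_of_le hj (min_le_left _ _)
  have hj2 : d i₀ j < 1 / 2 := lt_of_lt_of_le hj (min_le_right _ _)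
  have hij : d i j ≤ 1 := by
    have := hd.triangle i i₀ j
    rw [hd.symm i i₀] at this
    linarith
  refine (h i hi1 j hj1).trans (mul_le_mul_of_nonneg_left ?_ hM)
  exact Real.rpow_le_rpow_of_exponent_ge_of_imp (hd.nonneg i j) hij hβα
    (fun _ h0 => absurd h0 (hβ.trans_le hβα).ne')

lemma PtHolderAt.mono_exponent (hβα : β ≤ α)
    (h : PtHolderAt d f i₀ α) : PtHolderAt d f i₀ β := by
  obtain ⟨r, hr, M, hM, h⟩ := h
  refine ⟨min r 1, by positivity, M, hM, fun ρ hρ hρr i hi j hj => ?_⟩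
  refine (h ρ hρ (hρr.trans_le (min_le_left _ _)) i hi j hj).trans
    (mul_le_mul_of_nonneg_left ?_ hM)
  exact Real.rpow_le_rpow_of_exponent_ge hρ (hρr.le.trans (min_le_right _ _)) hβα

lemma LocHolderAt.ptHolderAt (hd : IsPseudoDist d) (hα : 0 < α)
    (h : LocHolderAt d f i₀ α) : PtHolderAt d f i₀ α := by
  obtain ⟨r, hr, M, hM, h⟩ := h
  refine ⟨r, hr, M * 2 ^ α, by positivity, fun ρ hρ hρr i hi j hj => ?_⟩
  refine (h i (lt_trans hi hρr) j (lt_trans hj hρr)).trans ?_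
  rw [mul_assoc, ← Real.mul_rpow zero_le_two hρ.le]
  refine mul_le_mul_of_nonneg_left (Real.rpow_le_rpow (hd.nonneg i j) ?_ hα.le) hM
  have := hd.triangle i i₀ j
  rw [hd.symm i i₀] at this
  have hi : d i₀ i < ρ := hi
  have hj : d i₀ j < ρ := hj
  linarith

lemma EquivalentDist.symm (h : EquivalentDist d d') : EquivalentDist d' d := by
  obtain ⟨c, C, hc, hC, h⟩ := h
  refine ⟨C⁻¹, c⁻¹, by positivity, by positivity, fun i j => ⟨?_, ?_⟩⟩
  · rw [inv_mul_le_iff₀ hC]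
    exact (h i j).2
  · rw [le_inv_mul_iff₀ hc]
    exact (h i j).1

lemma LocHolderAt.of_equivalentDist (hd : IsPseudoDist d) (hα : 0 < α)
    (hdd : EquivalentDist d d') (h : LocHolderAt d f i₀ α) : LocHolderAt d' f i₀ α := by
  obtain ⟨c, C, hc, hC, hcC⟩ := hdd
  obtain ⟨r, hr, M, hM, h⟩ := h
  have key : ∀ i, d' i₀ i < r / C → d i₀ i < r := fun i hi =>
    ((hcC i₀ i).2).trans_lt (by rwa [lt_div_iff₀' hC] at hi)
  refine ⟨r / C, by positivity, M * C ^ α, by positivity, fun i hi j hj => ?_⟩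
  refine (h i (key i hi) j (key j hj)).trans ?_
  have h0 : 0 ≤ d' i j := by
    have := (hd.nonneg i j).trans (hcC i j).2
    exact nonneg_of_mul_nonneg_right this hC
  rw [mul_assoc, ← Real.mul_rpow hC.le h0]
  exact mul_le_mul_of_nonneg_left (Real.rpow_le_rpow (hd.nonneg i j) (hcC i j).2 hα.le) hM

lemma PtHolderAt.of_equivalentDist
    (hdd : EquivalentDist d d') (h : PtHolderAt d f i₀ α) : PtHolderAt d' f i₀ α := by
  obtain ⟨c, C, hc, hC, hcC⟩ := hdd
  obtain ⟨r, hr, M, hM, h⟩ := h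
  refine ⟨r / C, by positivity, M * C ^ α, by positivity, fun ρ hρ hρr i hi j hj => ?_⟩
  rw [lt_div_iff₀' hC] at hρr
  rw [mul_assoc, ← Real.mul_rpow hC.le hρ.le]
  exact h (C * ρ) (by positivity) hρr
    i (((hcC i₀ i).2).trans_lt (mul_lt_mul_of_pos_left hi hC))
    j (((hcC i₀ j).2).trans_lt (mul_lt_mul_of_pos_left hj hC))

/-- If `p` is antitone on the positive reals and changes truth value at `H`, then its supremum
is `H`; it is enough to test `p` along sequences converging to `H`. -/
lemma iSup_eq_of_threshold {p : ℝ → Prop} (hH : 0 < H)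
    (hmono : ∀ α β, 0 < β → β ≤ α → p α → p β)
    (hlo : ∀ n : ℕ, p (H * (1 - 1 / (n + 2)))) (hup : ∀ n : ℕ, ¬ p (H * (1 + 1 / (n + 1)))) :
    (⨆ (α : ℝ) (_ : p α), (α : EReal)) = (H : EReal) := by
  have t0 : Tendsto (fun n : ℕ => (1 : ℝ) / (n + 1)) atTop (𝓝 0) :=
    tendsto_one_div_add_atTop_nhds_zero_nat
  apply le_antisymm
  · refine iSup₂_le fun α hα => ?_
    rw [EReal.coe_le_coe_iff]
    by_contra! hlt
    have t1 : Tendsto (fun n : ℕ => H * (1 + 1 / ((n : ℝ) + 1))) atTop (𝓝 (H * (1 + 0))) :=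
      (t0.const_add 1).const_mul H
    rw [add_zero, mul_one] at t1
    obtain ⟨n, hn⟩ := (t1.eventually (gt_mem_nhds hlt)).exists
    exact hup n (hmono _ _ (by positivity) hn.le hα)
  · refine le_of_forall_lt fun x hx => ?_
    have t1 : Tendsto (fun n : ℕ => ((H * (1 - 1 / ((n : ℝ) + 2)) : ℝ) : EReal)) atTop
        (𝓝 (H : EReal)) := by
      have t2 : Tendsto (fun n : ℕ => (1 : ℝ) / (n + 2)) atTop (𝓝 0) := by
        have := t0.comp (tendsto_add_atTop_nat 1)
        refine this.congr fun n => ?_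
        simp only [Function.comp]
        push_cast
        ring_nf
      have t3 := (t2.const_sub 1).const_mul H
      rw [sub_zero, mul_one] at t3
      exact (continuous_coe_real_ereal.tendsto H).comp t3
    obtain ⟨n, hn⟩ := (t1.eventually (lt_mem_nhds hx)).exists
    exact hn.trans_le (le_iSup₂_of_le _ (hlo n) le_rfl)

lemma localHolderExponent_eq (hd : IsPseudoDist d) (hd' : IsPseudoDist d')
    (hdd : EquivalentDist d d') (hH : 0 < H)
    (hlo : ∀ n : ℕ, LocHolderAt d' f i₀ (H * (1 - 1 / (n + 2))))
    (hup : ∀ n : ℕ, ¬ LocHolderAt d' f i₀ (H * (1 + 1 / (n + 1)))) :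
    localHolderExponent d f i₀ = (H : EReal) := by
  -- The offset `n + 2` keeps even the first exponent positive, as the real-valued reformulation
  -- requires.
  have pos : ∀ n : ℕ, 0 < H * (1 - 1 / ((n : ℝ) + 2)) := fun n => by
    have : (1 : ℝ) / (n + 2) < 1 := by
      rw [div_lt_one (by positivity)]
      linarith [(n.cast_nonneg : (0 : ℝ) ≤ n)]
    exact mul_pos hH (by linarith)
  refine iSup_eq_of_threshold hH (fun α β hβ hβα h => ?_) (fun n => ?_) (fun n h => ?_)
  · rw [limsup_local_lt_top_iff hd hβ]
    exact ((limsup_local_lt_top_iff hd (hβ.trans_le hβα)).1 h).mono_exponent hd hβ hβα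
  · rw [limsup_local_lt_top_iff hd (pos n)]
    exact (hlo n).of_equivalentDist hd' (pos n) hdd.symm
  · have hp : 0 < H * (1 + 1 / ((n : ℝ) + 1)) := by positivity
    exact hup n (((limsup_local_lt_top_iff hd hp).1 h).of_equivalentDist hd hp hdd)

lemma pointwiseHolderExponent_eq (hd' : IsPseudoDist d')
    (hdd : EquivalentDist d d') (hH : 0 < H)
    (hlo : ∀ n : ℕ, LocHolderAt d' f i₀ (H * (1 - 1 / (n + 2))))
    (hup : ∀ n : ℕ, ¬ PtHolderAt d' f i₀ (H * (1 + 1 / (n + 1)))) :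
    pointwiseHolderExponent d f i₀ = (H : EReal) := by
  have pos : ∀ n : ℕ, 0 < H * (1 - 1 / ((n : ℝ) + 2)) := fun n => by
    have : (1 : ℝ) / (n + 2) < 1 := by
      rw [div_lt_one (by positivity)]
      linarith [(n.cast_nonneg : (0 : ℝ) ≤ n)]
    exact mul_pos hH (by linarith)
  refine iSup_eq_of_threshold hH (fun α β hβ hβα h => ?_) (fun n => ?_) (fun n h => ?_)
  · rw [limsup_pointwise_lt_top_iff hβ]
    exact ((limsup_pointwise_lt_top_iff (hβ.trans_le hβα)).1 h).mono_exponent hβα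
  · rw [limsup_pointwise_lt_top_iff (pos n)]
    exact ((hlo n).ptHolderAt hd' (pos n)).of_equivalentDist hdd.symm
  · have hp : 0 < H * (1 + 1 / ((n : ℝ) + 1)) := by positivity
    exact hup n (((limsup_pointwise_lt_top_iff hp).1 h).of_equivalentDist hdd)

end HolderAt

/-! ### Gaussian estimates -/

section Gaussian

variable {Ω : Type*} [MeasurableSpace Ω] {P : Measure Ω} [IsProbabilityMeasure P]

/-- Chernoff's bound for `Y` and for `-Y`. -/
lemma measureReal_abs_ge_le_of_hasGaussianLaw {Y : Ω → ℝ} (hY : HasGaussianLaw Y P)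
    (h0 : ∫ ω, Y ω ∂P = 0) {s x : ℝ} (hs : Var[Y; P] ≤ s) (hx : 0 ≤ x) :
    P.real {ω | x ≤ |Y ω|} ≤ 2 * Real.exp (-x ^ 2 / (2 * s)) := by
  have hs0 : 0 ≤ s := (variance_nonneg Y P).trans hs
  have main : ∀ Z : Ω → ℝ, HasGaussianLaw Z P → ∫ ω, Z ω ∂P = 0 → Var[Z; P] ≤ s →
      P.real {ω | x ≤ Z ω} ≤ Real.exp (-x ^ 2 / (2 * s)) := by
    intro Z hZ h0 hs
    have hmap := hZ.map_eq_gaussianReal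
    have hsub : HasSubgaussianMGF Z s.toNNReal P := by
      refine ⟨fun t => ?_, fun t => ?_⟩
      · have h1 : Integrable (fun x ↦ Real.exp (t * x)) (P.map Z) := by
          rw [hmap]
          exact integrable_exp_mul_gaussianReal t
        exact h1.comp_aemeasurable hZ.aemeasurable
      · rw [mgf_gaussianReal hmap, h0]
        have : ((Var[Z; P]).toNNReal : ℝ) ≤ s.toNNReal := by
          exact_mod_cast Real.toNNReal_le_toNNReal hs
        gcongr
        nlinarith [sq_nonneg t]
    have := hsub.measure_ge_le hx
    rwa [Real.coe_toNNReal _ hs0] at this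
  have hsplit : {ω | x ≤ |Y ω|} ⊆ {ω | x ≤ Y ω} ∪ {ω | x ≤ (-Y) ω} := by
    intro ω hω
    rcases le_abs.1 (show x ≤ |Y ω| from hω) with h | h
    · exact Or.inl h
    · exact Or.inr h
  calc P.real {ω | x ≤ |Y ω|} ≤ P.real ({ω | x ≤ Y ω} ∪ {ω | x ≤ (-Y) ω}) :=
        measureReal_mono hsplit
    _ ≤ P.real {ω | x ≤ Y ω} + P.real {ω | x ≤ (-Y) ω} := measureReal_union_le _ _
    _ ≤ _ := by
      have h1 := main Y hY h0 hs
      have h2 := main (-Y) hY.neg (by simp [integral_neg, h0]) (by rwa [variance_neg])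
      linarith

/-- A Gaussian density of standard deviation `ε⁻¹` is at most `ε / √(2π)`, and `exp (-x²/4)` has
Lebesgue integral `2√π`. -/
lemma integral_exp_neg_sq_gaussianReal_le {ε : ℝ} (hε : 0 < ε) :
    ∫ x, Real.exp (-(x ^ 2 / 4)) ∂(gaussianReal 0 (ε⁻¹ ^ 2).toNNReal) ≤ Real.sqrt 2 * ε := by
  have hv : (ε⁻¹ ^ 2).toNNReal ≠ 0 := by
    simp [Real.toNNReal_eq_zero, hε.ne']
  rw [integral_gaussianReal_eq_integral_smul hv]
  have hc : ((ε⁻¹ ^ 2).toNNReal : ℝ) = ε⁻¹ ^ 2 := Real.coe_toNNReal _ (by positivity)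
  have hint : Integrable (fun x : ℝ => (Real.sqrt (2 * Real.pi * ε⁻¹ ^ 2))⁻¹ *
      Real.exp (-(1 / 4) * x ^ 2)) := (integrable_exp_neg_mul_sq (by norm_num)).const_mul _
  calc _ ≤ ∫ x : ℝ, (Real.sqrt (2 * Real.pi * ε⁻¹ ^ 2))⁻¹ * Real.exp (-(1 / 4) * x ^ 2) := by
        refine integral_mono_of_nonneg (ae_of_all _ fun x => ?_) hint (ae_of_all _ fun x => ?_)
        · exact smul_nonneg (gaussianPDFReal_nonneg _ _ _) (Real.exp_nonneg _)
        · simp only [gaussianPDFReal, smul_eq_mul, hc]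
          have h1 : Real.exp (-(x - 0) ^ 2 / (2 * ε⁻¹ ^ 2)) ≤ 1 := by
            rw [Real.exp_le_one_iff]
            exact div_nonpos_of_nonpos_of_nonneg (by nlinarith [sq_nonneg (x - 0)]) (by positivity)
          have h2 : Real.exp (-(x ^ 2 / 4)) = Real.exp (-(1 / 4) * x ^ 2) := by ring_nf
          rw [h2]
          refine mul_le_mul_of_nonneg_right ?_ (Real.exp_nonneg _)
          exact mul_le_of_le_one_right (by positivity) h1
    _ = Real.sqrt 2 * ε := by
        rw [integral_const_mul, integral_gaussian]
        have h1 : Real.pi / (1 / 4) = 2 * Real.pi * 2 := by ring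
        have hp := Real.pi_pos
        rw [h1, Real.sqrt_mul (by positivity) (2 : ℝ), Real.sqrt_mul (by positivity) (ε⁻¹ ^ 2),
          Real.sqrt_sq (by positivity)]
        have h2 : Real.sqrt (2 * Real.pi) ≠ 0 := (Real.sqrt_pos.2 (by positivity)).ne'
        field_simp

/-- Small ball estimate for a centered Gaussian vector whose covariance matrix is at least half
the identity. -/
lemma measureReal_forall_abs_le {κ : Type*} [Fintype κ] {Z : κ → Ω → ℝ}
    (hZ : HasGaussianLaw (fun ω i => Z i ω) P) (h0 : ∀ i, ∫ ω, Z i ω ∂P = 0)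
    (hvar : ∀ a : κ → ℝ, 1 / 2 * ∑ i, a i ^ 2 ≤ Var[fun ω => ∑ i, a i * Z i ω; P])
    {ε : κ → ℝ} (hε : ∀ i, 0 < ε i) :
    P.real {ω | ∀ i, |Z i ω| ≤ ε i} ≤ ∏ i, (3 * ε i) := by
  classical
  set v : κ → NNReal := fun i => ((ε i)⁻¹ ^ 2).toNNReal with hv
  have hvc : ∀ i, (v i : ℝ) = (ε i)⁻¹ ^ 2 := fun i => Real.coe_toNNReal _ (by positivity)
  set μ : Measure (κ → ℝ) := Measure.pi fun i => gaussianReal 0 (v i) with hμ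
  set W : Ω → κ → ℝ := fun ω i => Z i ω with hW
  have hWm : AEMeasurable W P := hZ.aemeasurable
  set Q : Measure (κ → ℝ) := P.map W with hQ
  have : IsProbabilityMeasure Q := Measure.isProbabilityMeasure_map hWm
  set G : (κ → ℝ) → ℝ := fun z => ∏ i, Real.exp (-(v i * z i ^ 2 / 2)) with hG
  have hGc : Continuous G := by fun_prop
  have hG1 : ∀ z, G z ≤ 1 := fun z => Finset.prod_le_one (fun i _ => Real.exp_nonneg _)
    (fun i _ => by
      rw [Real.exp_le_one_iff, Left.neg_nonpos_iff]
      positivity)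
  have hG0 : ∀ z, 0 ≤ G z := fun z => Finset.prod_nonneg fun i _ => Real.exp_nonneg _
  have hGint : Integrable G Q := by
    refine Integrable.of_bound hGc.aestronglyMeasurable 1 (ae_of_all _ fun z => ?_)
    rw [Real.norm_of_nonneg (hG0 z)]
    exact hG1 z
  have hB : MeasurableSet {z : κ → ℝ | ∀ i, |z i| ≤ ε i} := by
    rw [Set.ofPred_forall]
    exact MeasurableSet.iInter fun i =>
      measurableSet_le ((measurable_pi_apply i).abs) measurable_const
  -- On the box each factor of `G` is at least `exp (-1/2)`, so the indicator is dominated by a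
  -- multiple of `G`.
  have step1 : P.real {ω | ∀ i, |Z i ω| ≤ ε i} ≤
      Real.exp (1 / 2) ^ Fintype.card κ * ∫ z, G z ∂Q := by
    have e1 : P.real {ω | ∀ i, |Z i ω| ≤ ε i} = Q.real {z : κ → ℝ | ∀ i, |z i| ≤ ε i} := by
      rw [hQ, map_measureReal_apply_of_aemeasurable hWm hB]
      rfl
    rw [e1, ← integral_indicator_one hB, ← integral_const_mul]
    refine integral_mono_of_nonneg (ae_of_all _ fun z => ?_) (hGint.const_mul _)
      (ae_of_all _ fun z => ?_)
    · exact Set.indicator_nonneg (fun _ _ => zero_le_one) z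
    · by_cases hz : z ∈ {z : κ → ℝ | ∀ i, |z i| ≤ ε i}
      · simp only [Set.indicator_of_mem hz, Pi.one_apply, hG]
        rw [← Finset.card_univ, ← Finset.prod_const, ← Finset.prod_mul_distrib]
        refine le_trans (by simp) (Finset.prod_le_prod (f := fun _ : κ => (1 : ℝ))
          (fun _ _ => zero_le_one) fun i _ => ?_)
        rw [← Real.exp_add, Real.one_le_exp_iff, hvc]
        have h1 : ((ε i)⁻¹ * z i) ^ 2 ≤ 1 := by
          rw [sq_le_one_iff_abs_le_one, abs_mul, abs_of_pos (inv_pos.2 (hε i)),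
            inv_mul_le_iff₀ (hε i), mul_one]
          exact hz i
        rw [mul_pow] at h1
        linarith
      · simp only [Set.indicator_of_notMem hz]
        exact mul_nonneg (by positivity) (hG0 z)
  -- `G` is the characteristic function of the auxiliary Gaussian measure `μ`, whose variances are
  -- `(ε i)⁻²`.
  have step2 : ∀ z : κ → ℝ, ((G z : ℝ) : ℂ) =
      ∫ x, Complex.exp ((∑ i, x i * z i : ℝ) * Complex.I) ∂μ := by
    intro z
    have h1 : ∀ x : κ → ℝ, Complex.exp ((∑ i, x i * z i : ℝ) * Complex.I) =
        ∏ i, Complex.exp (z i * x i * Complex.I) := by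
      intro x
      rw [← Complex.exp_sum, ← Finset.sum_mul]
      push_cast
      simp only [mul_comm]
    simp_rw [h1]
    rw [hμ, integral_fintype_prod_eq_prod (fun i (x : ℝ) => Complex.exp (z i * x * Complex.I)),
      hG]
    push_cast
    refine Finset.prod_congr rfl fun i _ => ?_
    rw [← charFun_apply_real, charFun_gaussianReal]
    congr 1
    push_cast
    ring
  have step3 : ∀ x : κ → ℝ, ∫ z, Complex.exp ((∑ i, x i * z i : ℝ) * Complex.I) ∂Q =
      ((Real.exp (-(Var[fun ω => ∑ i, x i * Z i ω; P] / 2)) : ℝ) : ℂ) := by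
    intro x
    set Lx : StrongDual ℝ (κ → ℝ) := ∑ i, x i • ContinuousLinearMap.proj (R := ℝ) i with hL
    have hLa : ∀ z, Lx z = ∑ i, x i * z i := fun z => by simp [hL]
    have h1 := hZ.charFunDual_map_eq_fun Lx
    rw [charFunDual_apply] at h1
    simp only [hLa] at h1
    rw [hQ, h1]
    have h2 : ∫ ω, ((∑ i, x i * Z i ω : ℝ)) ∂P = 0 := by
      rw [integral_finsetSum _ fun i _ => ((hZ.eval i).integrable.const_mul _)]
      simp [integral_const_mul, h0]
    have h3 : ∫ ω, ∑ i, x i * W ω i ∂P = 0 := h2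
    rw [h3]
    push_cast
    simp only [zero_mul, zero_sub]
    rfl
  -- Fubini trades the unknown law `Q` for its characteristic function, which involves only
  -- variances; no density is needed.
  have step4 : ∫ z, G z ∂Q = ∫ x, Real.exp (-(Var[fun ω => ∑ i, x i * Z i ω; P] / 2)) ∂μ := by
    have : ((∫ z, G z ∂Q : ℝ) : ℂ) =
        ((∫ x, Real.exp (-(Var[fun ω => ∑ i, x i * Z i ω; P] / 2)) ∂μ : ℝ) : ℂ) := by
      rw [← integral_complex_ofReal, ← integral_complex_ofReal]
      simp_rw [step2, ← step3]
      refine integral_integral_swap ?_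
      refine Integrable.of_bound (Continuous.aestronglyMeasurable ?_) 1 (ae_of_all _ fun p => ?_)
      · simp only [Function.uncurry_def]
        fun_prop
      · simp only [Function.uncurry_def]
        rw [Complex.norm_exp_ofReal_mul_I]
    exact_mod_cast this
  have step5 : ∫ x, Real.exp (-(Var[fun ω => ∑ i, x i * Z i ω; P] / 2)) ∂μ ≤
      ∏ i, (Real.sqrt 2 * ε i) := by
    calc _ ≤ ∫ x, ∏ i, Real.exp (-(x i ^ 2 / 4)) ∂μ := by
          refine integral_mono_of_nonneg (ae_of_all _ fun x => Real.exp_nonneg _) ?_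
            (ae_of_all _ fun x => ?_)
          · refine Integrable.of_bound (Continuous.aestronglyMeasurable (by fun_prop)) 1
              (ae_of_all _ fun x => ?_)
            rw [Real.norm_of_nonneg (Finset.prod_nonneg fun i _ => Real.exp_nonneg _)]
            refine Finset.prod_le_one (fun i _ => Real.exp_nonneg _) fun i _ => ?_
            rw [Real.exp_le_one_iff]
            have := sq_nonneg (x i)
            linarith
          · simp only [← Real.exp_sum]
            rw [Real.exp_le_exp, Finset.sum_neg_distrib, ← Finset.sum_div]
            have := hvar x
            linarith
      _ = ∏ i, ∫ x, Real.exp (-(x ^ 2 / 4)) ∂(gaussianReal 0 (v i)) := by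
          rw [hμ, integral_fintype_prod_eq_prod (fun i (x : ℝ) => Real.exp (-(x ^ 2 / 4)))]
      _ ≤ _ := Finset.prod_le_prod (fun i _ => integral_nonneg fun x => Real.exp_nonneg _)
          fun i _ => integral_exp_neg_sq_gaussianReal_le (hε i)
  refine step1.trans ?_
  rw [step4, ← Finset.card_univ, ← Finset.prod_const]
  refine (mul_le_mul_of_nonneg_left step5 (by positivity)).trans ?_
  rw [← Finset.prod_mul_distrib]
  refine Finset.prod_le_prod (fun i _ => by have := (hε i).le; positivity) fun i _ => ?_
  rw [← mul_assoc]
  refine mul_le_mul_of_nonneg_right ?_ (hε i).le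
  -- The constant `3` comes from `√2 · e^{1/2} ≤ 3`, that is `2e ≤ 9`.
  refine abs_le_of_sq_le_sq' ?_ (by norm_num) |>.2
  rw [mul_pow, Real.sq_sqrt (by norm_num), ← Real.exp_nat_mul]
  have := Real.exp_one_lt_d9
  norm_num at this ⊢
  linarith

end Gaussian

/-! ### Fractional Gaussian fields on a pseudo-metric space -/

section Field

variable {Ω : Type*} [MeasurableSpace Ω] {P : Measure Ω}

lemma ae_eventually_notMem_of_summable [IsFiniteMeasure P] {s : ℕ → Set Ω} {g : ℕ → ℝ} (hg : Summable g)
    (hs : ∀ n, P.real (s n) ≤ g n) : ∀ᵐ ω ∂P, ∀ᶠ n in atTop, ω ∉ s n := by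
  refine ae_eventually_notMem (ne_top_of_le_ne_top hg.tsum_ofReal_ne_top ?_)
  refine ENNReal.tsum_le_tsum fun n => ?_
  rw [← ofReal_measureReal (measure_ne_top P _)]
  exact ENNReal.ofReal_le_ofReal (hs n)

lemma hasGaussianLaw_pi_of_isGaussianProcess {κ : Type*} [Fintype κ] {Y : κ → Ω → ℝ}
    (hY : IsGaussianProcess Y P) : HasGaussianLaw (fun ω i => Y i ω) P := by
  let L : ({i // i ∈ (Finset.univ : Finset κ)} → ℝ) →L[ℝ] (κ → ℝ) :=
    { toFun := fun x i => x ⟨i, Finset.mem_univ i⟩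
      map_add' := fun x y => rfl
      map_smul' := fun c x => rfl }
  exact (hY.hasGaussianLaw Finset.univ).map L

variable {ι : Type*} {d : ι → ι → ℝ} {φ : ι → ℝ} {H : ℝ} {X : ι → Ω → ℝ}

/-- A centered Gaussian field with covariance `(φ i + φ j - d(i, j) ^ (2H)) / 2`. -/
structure IsFractionalField (d : ι → ι → ℝ) (φ : ι → ℝ) (H : ℝ) (X : ι → Ω → ℝ)
    (P : Measure Ω) : Prop where
  isGaussian : IsGaussianProcess X P
  centered : ∀ i, ∫ ω, X i ω ∂P = 0
  covariance : ∀ i j, ∫ ω, X i ω * X j ω ∂P = 1 / 2 * (φ i + φ j - d i j ^ (2 * H))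

/-- Subadditivity of `x ↦ x ^ p` for `p ≤ 1`; applied with `p = 2H`, it is where `H ≤ 1/2` matters.
-/
lemma rpow_sub_rpow_le {a b c p : ℝ} (ha : 0 ≤ a) (hb : 0 ≤ b) (hc : 0 ≤ c) (hp : 0 ≤ p)
    (hp1 : p ≤ 1) (h : a ≤ b + c) : a ^ p - b ^ p ≤ c ^ p := by
  have h1 := Real.rpow_le_rpow ha h hp
  have h2 := Real.rpow_add_le_add_rpow hb hc hp hp1
  linarith

namespace IsFractionalField

lemma integral_increment (hX : IsFractionalField d φ H X P) (u v : ι) :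
    ∫ ω, (X u ω - X v ω) ∂P = 0 := by
  rw [integral_sub (hX.isGaussian.hasGaussianLaw_eval u).integrable
    (hX.isGaussian.hasGaussianLaw_eval v).integrable, hX.centered, hX.centered, sub_zero]

lemma integrable_mul (hX : IsFractionalField d φ H X P) (u v : ι) :
    Integrable (fun ω => X u ω * X v ω) P :=
  (hX.isGaussian.hasGaussianLaw_eval u).memLp_two.integrable_mul
    (hX.isGaussian.hasGaussianLaw_eval v).memLp_two

lemma integral_increment_mul (hX : IsFractionalField d φ H X P) (u v u' v' : ι) :
    ∫ ω, (X u ω - X v ω) * (X u' ω - X v' ω) ∂P =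
      1 / 2 * (d u v' ^ (2 * H) + d v u' ^ (2 * H) - d u u' ^ (2 * H) - d v v' ^ (2 * H)) := by
  have e : ∀ ω, (X u ω - X v ω) * (X u' ω - X v' ω) =
      (X u ω * X u' ω - X u ω * X v' ω) - (X v ω * X u' ω - X v ω * X v' ω) := fun ω => by ring
  simp_rw [e]
  have i1 : ∀ a b c, Integrable (fun ω => X a ω * X b ω - X a ω * X c ω) P := fun a b c =>
    (hX.integrable_mul a b).sub (hX.integrable_mul a c)
  rw [integral_sub (i1 _ _ _) (i1 _ _ _),
    integral_sub (hX.integrable_mul _ _) (hX.integrable_mul _ _),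
    integral_sub (hX.integrable_mul _ _) (hX.integrable_mul _ _)]
  simp only [hX.covariance]
  ring

lemma integral_increment_sq (hX : IsFractionalField d φ H X P) (hd : IsPseudoDist d)
    (hH0 : 0 < H) (u v : ι) :
    ∫ ω, (X u ω - X v ω) * (X u ω - X v ω) ∂P = d u v ^ (2 * H) := by
  rw [hX.integral_increment_mul, hd.self, hd.self, hd.symm v u,
    Real.zero_rpow (by positivity)]
  ring

/-- Since `d ^ (2H)` satisfies the triangle inequality, replacing `u'` by `v'` changes each of the
two terms by at most `d u' v' ^ (2H)`. The bound involves one pair only, so it can be taken to be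
the pair at the smaller scale. -/
lemma abs_integral_increment_mul_le (hX : IsFractionalField d φ H X P) (hd : IsPseudoDist d)
    (hH0 : 0 < H) (hH : H ≤ 1 / 2) (u v u' v' : ι) :
    |∫ ω, (X u ω - X v ω) * (X u' ω - X v' ω) ∂P| ≤ d u' v' ^ (2 * H) := by
  rw [hX.integral_increment_mul]
  have key : ∀ a, d a v' ^ (2 * H) - d a u' ^ (2 * H) ≤ d u' v' ^ (2 * H) ∧
      d a u' ^ (2 * H) - d a v' ^ (2 * H) ≤ d u' v' ^ (2 * H) := fun a =>
    ⟨rpow_sub_rpow_le (hd.nonneg _ _) (hd.nonneg _ _) (hd.nonneg _ _) (by positivity)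
      (by linarith) (hd.triangle _ _ _),
     rpow_sub_rpow_le (hd.nonneg _ _) (hd.nonneg _ _) (hd.nonneg _ _) (by positivity)
      (by linarith) (by rw [hd.symm u' v']; exact hd.triangle _ _ _)⟩
  have h1 := key u
  have h2 := key v
  rw [abs_le]
  constructor <;> linarith

lemma variance_increment (hX : IsFractionalField d φ H X P) (hd : IsPseudoDist d)
    (hH0 : 0 < H) (u v : ι) : Var[fun ω => X u ω - X v ω; P] = d u v ^ (2 * H) := by
  rw [variance_of_integral_eq_zero (hX.isGaussian.hasGaussianLaw_fun_sub).aemeasurable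
    (hX.integral_increment u v), ← hX.integral_increment_sq hd hH0]
  simp_rw [sq]

lemma measureReal_le_abs_increment [IsProbabilityMeasure P]
    (hX : IsFractionalField d φ H X P) (hd : IsPseudoDist d)
    (hH0 : 0 < H) {u v : ι} {s x : ℝ} (hs : d u v ≤ s) (hx : 0 ≤ x) :
    P.real {ω | x ≤ |X u ω - X v ω|} ≤ 2 * Real.exp (-x ^ 2 / (2 * s ^ (2 * H))) := by
  refine measureReal_abs_ge_le_of_hasGaussianLaw hX.isGaussian.hasGaussianLaw_fun_sub
    (hX.integral_increment u v) ?_ hx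
  rw [hX.variance_increment hd hH0]
  exact Real.rpow_le_rpow (hd.nonneg _ _) hs (by positivity)

/-- Increments over pairs at well separated scales are nearly orthogonal, hence jointly small with
probability at most the product of the individual bounds. -/
lemma measureReal_forall_increment_le [IsProbabilityMeasure P]
    (hX : IsFractionalField d φ H X P) (hd : IsPseudoDist d)
    (hH0 : 0 < H) (hH : H ≤ 1 / 2) {K : ℕ} {u v : Fin K → ι} (hpos : ∀ l, 0 < d (u l) (v l))
    (hsep : ∀ l l', l < l' → (d (u l') (v l') / d (u l) (v l)) ^ H ≤ 1 / (2 * K))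
    {e : Fin K → ℝ} (he : ∀ l, 0 < e l) :
    P.real {ω | ∀ l, |X (u l) ω - X (v l) ω| ≤ e l} ≤
      ∏ l, (3 * (e l / d (u l) (v l) ^ H)) := by
  classical
  set σ : Fin K → ℝ := fun l => d (u l) (v l) ^ H with hσ
  have hσ0 : ∀ l, 0 < σ l := fun l => Real.rpow_pos_of_pos (hpos l) _
  have hσ2 : ∀ l, d (u l) (v l) ^ (2 * H) = σ l * σ l := fun l => by
    rw [hσ, ← Real.rpow_add (hpos l)]
    ring_nf
  set Z : Fin K → Ω → ℝ := fun l ω => (σ l)⁻¹ * (X (u l) ω - X (v l) ω) with hZ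
  have hZp : IsGaussianProcess Z P := by
    refine hX.isGaussian.of_isGaussianProcess fun l => ⟨{u l, v l},
      { toFun := fun x => (σ l)⁻¹ * (x ⟨u l, by simp⟩ - x ⟨v l, by simp⟩)
        map_add' := fun x y => by simp; ring
        map_smul' := fun c x => by simp; ring }, fun ω => ?_⟩
    simp [hZ]
  have hZ0 : ∀ l, ∫ ω, Z l ω ∂P = 0 := fun l => by
    simp only [hZ]
    rw [integral_const_mul, hX.integral_increment, mul_zero]
  have hZm : ∀ l l', Integrable (fun ω => Z l ω * Z l' ω) P := fun l l' =>
    (hZp.hasGaussianLaw_eval l).memLp_two.integrable_mul (hZp.hasGaussianLaw_eval l').memLp_two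
  have hcov : ∀ l l', ∫ ω, Z l ω * Z l' ω ∂P = (σ l)⁻¹ * (σ l')⁻¹ *
      ∫ ω, (X (u l) ω - X (v l) ω) * (X (u l') ω - X (v l') ω) ∂P := fun l l' => by
    rw [← integral_const_mul]
    congr 1
    ext ω
    simp only [hZ]
    ring
  have hdiag : ∀ l, ∫ ω, Z l ω * Z l ω ∂P = 1 := fun l => by
    rw [hcov, hX.integral_increment_sq hd hH0, hσ2]
    have := (hσ0 l).ne'
    field_simp
  -- After normalization the covariance is at most the ratio of the smaller to the larger standard
  -- deviation, which the separation of scales controls.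
  have hlt : ∀ l l', l < l' → |∫ ω, Z l ω * Z l' ω ∂P| ≤ 1 / (2 * K) := fun l l' hll => by
    rw [hcov, abs_mul, abs_of_pos (mul_pos (inv_pos.2 (hσ0 l)) (inv_pos.2 (hσ0 l')))]
    have h1 := hX.abs_integral_increment_mul_le hd hH0 hH (u l) (v l) (u l') (v l')
    rw [hσ2] at h1
    have h2 := hsep l l' hll
    rw [Real.div_rpow (hd.nonneg _ _) (hd.nonneg _ _)] at h2
    refine le_trans ?_ h2
    calc _ ≤ (σ l)⁻¹ * (σ l')⁻¹ * (σ l' * σ l') :=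
          mul_le_mul_of_nonneg_left h1
            (mul_nonneg (inv_nonneg.2 (hσ0 l).le) (inv_nonneg.2 (hσ0 l').le))
      _ = σ l' / σ l := by
          have := (hσ0 l).ne'
          have := (hσ0 l').ne'
          field_simp
  have hoff : ∀ l l', l ≠ l' → |∫ ω, Z l ω * Z l' ω ∂P| ≤ 1 / (2 * K) := fun l l' hne => by
    rcases lt_or_gt_of_ne hne with h | h
    · exact hlt l l' h
    · simp_rw [mul_comm (Z l _)]
      exact hlt l' l h
  have hvar : ∀ a : Fin K → ℝ,
      1 / 2 * ∑ l, a l ^ 2 ≤ Var[fun ω => ∑ l, a l * Z l ω; P] := by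
    intro a
    rw [variance_of_integral_eq_zero]
    rotate_left
    · exact Finset.aemeasurable_fun_sum _ fun l _ =>
        (hZp.hasGaussianLaw_eval l).aemeasurable.const_mul _
    · rw [integral_finsetSum _ fun l _ => ((hZp.hasGaussianLaw_eval l).integrable.const_mul _)]
      simp [integral_const_mul, hZ0]
    have e1 : ∀ ω, (∑ l, a l * Z l ω) ^ 2 = ∑ l, ∑ l', a l * a l' * (Z l ω * Z l' ω) := by
      intro ω
      rw [sq, Finset.sum_mul_sum]
      refine Finset.sum_congr rfl fun l _ => Finset.sum_congr rfl fun l' _ => by ring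
    simp_rw [e1]
    rw [integral_finsetSum _ fun l _ => integrable_finsetSum _ fun l' _ => (hZm l l').const_mul _]
    have e2 : ∀ l, ∫ ω, ∑ l', a l * a l' * (Z l ω * Z l' ω) ∂P =
        ∑ l', a l * a l' * ∫ ω, Z l ω * Z l' ω ∂P := fun l => by
      rw [integral_finsetSum _ fun l' _ => (hZm l l').const_mul _]
      simp only [integral_const_mul]
    simp_rw [e2]
    -- Diagonal dominance: `|a l * a l'|` is split by the arithmetic-geometric inequality. Summing
    -- the error terms over all pairs costs exactly half of `∑ a l ^ 2`.
    have e3 : ∀ l l', (if l = l' then a l ^ 2 else 0) - (a l ^ 2 + a l' ^ 2) / (4 * K) ≤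
        a l * a l' * ∫ ω, Z l ω * Z l' ω ∂P := by
      intro l l'
      by_cases h : l = l'
      · subst h
        rw [if_pos rfl, hdiag]
        have : 0 ≤ (a l ^ 2 + a l ^ 2) / (4 * K) := by positivity
        nlinarith
      · rw [if_neg h]
        have h1 : |a l * a l' * ∫ ω, Z l ω * Z l' ω ∂P| ≤
            (a l ^ 2 + a l' ^ 2) / 2 * (1 / (2 * K)) := by
          rw [abs_mul]
          refine mul_le_mul ?_ (hoff l l' h) (abs_nonneg _) (by positivity)
          rw [abs_le]
          constructor <;> nlinarith [sq_nonneg (a l - a l'), sq_nonneg (a l + a l')]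
        have h2 := (abs_le.1 h1).1
        have h3 : (a l ^ 2 + a l' ^ 2) / 2 * (1 / (2 * K)) =
          (a l ^ 2 + a l' ^ 2) / (4 * (K : ℝ)) := by
          rcases Nat.eq_zero_or_pos K with h0 | h0
          · simp [h0]
          · field_simp
            ring
        linarith
    refine le_trans ?_ (Finset.sum_le_sum fun l _ => Finset.sum_le_sum fun l' _ => e3 l l')
    rcases Nat.eq_zero_or_pos K with h0 | h0
    · subst h0
      simp
    · simp only [Finset.sum_sub_distrib, Finset.sum_ite_eq, Finset.mem_univ, if_true,
        ← Finset.sum_div, Finset.sum_add_distrib, Finset.sum_const, Finset.card_univ,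
        Fintype.card_fin, nsmul_eq_mul, ← Finset.mul_sum]
      apply le_of_eq
      field_simp
      ring
  have hfin := measureReal_forall_abs_le (hasGaussianLaw_pi_of_isGaussianProcess hZp) hZ0 hvar
    (ε := fun l => e l / σ l) (fun l => div_pos (he l) (hσ0 l))
  refine le_trans (measureReal_mono ?_) hfin
  intro ω hω l
  have h1 : |X (u l) ω - X (v l) ω| ≤ e l := hω l
  simp only [hZ]
  rw [abs_mul, abs_of_pos (inv_pos.2 (hσ0 l)), inv_mul_eq_div]
  exact div_le_div_of_nonneg_right h1 (hσ0 l).le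

end IsFractionalField

end Field

/-! ### Irregularity of fractional Gaussian fields -/

section Lower

variable {Ω : Type*} [MeasurableSpace Ω] {P : Measure Ω}
  {ι : Type*} {d : ι → ι → ℝ} {φ : ι → ℝ} {H β : ℝ} {X : ι → Ω → ℝ} {A : Set ι}

/-- `A` is covered by at most `C ε ^ (-q)` balls of radius `ε`, for every `ε ∈ (0, 1]`. -/
def PolyCovering (d : ι → ι → ℝ) (A : Set ι) : Prop :=
  ∃ (C : ℝ) (q : ℕ), 0 < C ∧ ∀ ε : ℝ, 0 < ε → ε ≤ 1 →
    ∃ F : Finset ι, (F.card : ℝ) ≤ C * ε⁻¹ ^ q ∧ ∀ i ∈ A, ∃ j ∈ F, d i j ≤ ε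

lemma PolyCovering.mono {B : Set ι} (hA : PolyCovering d A) (hB : B ⊆ A) : PolyCovering d B := by
  obtain ⟨C, q, hC, h⟩ := hA
  refine ⟨C, q, hC, fun ε hε hε1 => ?_⟩
  obtain ⟨F, hF, hF2⟩ := h ε hε hε1
  exact ⟨F, hF, fun i hi => hF2 i (hB hi)⟩

/-- Centres can be moved into `A` by halving the radius: each useful centre is replaced by a point
of `A` in its ball. This matters because large pairs are assumed only around points of `A`. -/
lemma PolyCovering.exists_subset (hd : IsPseudoDist d) (hA : PolyCovering d A) :
    ∃ (C : ℝ) (q : ℕ), 0 < C ∧ ∀ ε : ℝ, 0 < ε → ε ≤ 1 →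
      ∃ F : Finset ι, (∀ j ∈ F, j ∈ A) ∧ (F.card : ℝ) ≤ C * ε⁻¹ ^ q ∧
        ∀ i ∈ A, ∃ j ∈ F, d i j ≤ ε := by
  classical
  obtain ⟨C, q, hC, h⟩ := hA
  refine ⟨C * 2 ^ q, q, by positivity, fun ε hε hε1 => ?_⟩
  obtain ⟨F, hF, hF2⟩ := h (ε / 2) (by positivity) (by linarith)
  let rep : ι → ι := fun j => if hj : ∃ i ∈ A, d i j ≤ ε / 2 then hj.choose else j
  have hrep : ∀ j, (∃ i ∈ A, d i j ≤ ε / 2) → rep j ∈ A ∧ d (rep j) j ≤ ε / 2 := fun j hj => by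
    simp only [rep, dif_pos hj]
    exact hj.choose_spec
  refine ⟨(F.filter fun j => ∃ i ∈ A, d i j ≤ ε / 2).image rep, fun j hj => ?_, ?_,
    fun i hi => ?_⟩
  · obtain ⟨k, hk, rfl⟩ := Finset.mem_image.1 hj
    exact (hrep k (Finset.mem_filter.1 hk).2).1
  · have h1 : (((F.filter fun j => ∃ i ∈ A, d i j ≤ ε / 2).image rep).card : ℝ) ≤ F.card := by
      exact_mod_cast Finset.card_image_le.trans (Finset.card_filter_le _ _)
    refine h1.trans (hF.trans (le_of_eq ?_))
    rw [inv_div, div_pow, inv_pow]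
    field_simp
  · obtain ⟨j, hj, hij⟩ := hF2 i hi
    have hex : ∃ i ∈ A, d i j ≤ ε / 2 := ⟨i, hi, hij⟩
    refine ⟨rep j, Finset.mem_image_of_mem _ (Finset.mem_filter.2 ⟨hj, hex⟩), ?_⟩
    have h1 := hd.triangle i j (rep j)
    have h2 := (hrep j hex).2
    rw [hd.symm] at h2
    linarith

namespace IsFractionalField

variable [IsProbabilityMeasure P]

/-- For a fixed sequence of pairs a single increment suffices: the event for the constant `M + 1`
has probability at most a multiple of `d ^ (β - H)`, which tends to zero along the sequence. No
quasi-independence is used. -/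
lemma ae_not_forall_increment_le (hX : IsFractionalField d φ H X P) (hd : IsPseudoDist d)
    (hH0 : 0 < H) (hH : H ≤ 1 / 2) (hβ : H < β) {u v : ℕ → ι}
    (hpos : ∀ n, 0 < d (u n) (v n)) (hlim : Tendsto (fun n => d (u n) (v n)) atTop (𝓝 0)) :
    ∀ᵐ ω ∂P, ¬ ∃ M : ℝ, ∀ n, |X (u n) ω - X (v n) ω| ≤ M * d (u n) (v n) ^ β := by
  have main : ∀ M : ℕ, ∀ᵐ ω ∂P,
      ¬ ∀ n, |X (u n) ω - X (v n) ω| ≤ (M + 1 : ℝ) * d (u n) (v n) ^ β := by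
    intro M
    have hb : ∀ n, P.real {ω | ∀ n, |X (u n) ω - X (v n) ω| ≤ (M + 1 : ℝ) * d (u n) (v n) ^ β} ≤
        3 * (M + 1) * d (u n) (v n) ^ (β - H) := by
      intro n
      have h1 := hX.measureReal_forall_increment_le hd hH0 hH (K := 1) (u := fun _ => u n)
        (v := fun _ => v n) (fun _ => hpos n)
        (fun l l' hl => absurd hl (by rw [Subsingleton.elim l l']; exact lt_irrefl _))
        (e := fun _ => (M + 1 : ℝ) * d (u n) (v n) ^ β)
        (fun _ => mul_pos (by positivity) (Real.rpow_pos_of_pos (hpos n) _))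
      refine (measureReal_mono ?_).trans (h1.trans (le_of_eq ?_))
      · intro ω hω _
        exact hω n
      · rw [Fin.prod_univ_one, Real.rpow_sub (hpos n)]
        ring
    have ht : Tendsto (fun n => 3 * (M + 1 : ℝ) * d (u n) (v n) ^ (β - H)) atTop (𝓝 0) := by
      have h1 := (hlim.rpow_const (p := β - H) (Or.inr (by linarith))).const_mul (3 * (M + 1 : ℝ))
      rwa [Real.zero_rpow (by linarith), mul_zero] at h1
    have h0 := ge_of_tendsto' ht hb
    rw [ae_iff]
    simp only [not_not]
    have h2 := le_antisymm h0 measureReal_nonneg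
    rwa [measureReal_eq_zero_iff] at h2
  filter_upwards [ae_all_iff.2 main] with ω hω
  rintro ⟨M, hM⟩
  obtain ⟨m, hm⟩ := exists_nat_ge M
  refine hω m fun n => (hM n).trans ?_
  exact mul_le_mul_of_nonneg_right (by linarith) (Real.rpow_nonneg (hd.nonneg _ _) _)

/-- A Hölder bound near `i₀` holds on a whole ball of a countable family that contains arbitrarily
close pairs. Choosing one sequence of pairs per such ball, in advance of `ω`, reduces all `i₀` to
countably many null sets. -/
lemma ae_forall_not_locHolderAt (hX : IsFractionalField d φ H X P) (hd : IsPseudoDist d)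
    (hH0 : 0 < H) (hH : H ≤ 1 / 2) (hβ : H < β) (hA : PolyCovering d (Set.univ : Set ι)) :
    ∀ᵐ ω ∂P, ∀ i₀, (∀ r : ℝ, 0 < r → ∃ i, 0 < d i₀ i ∧ d i₀ i < r) →
      ¬ LocHolderAt d (fun i => X i ω) i₀ β := by
  obtain ⟨C, q, hC, h⟩ := hA
  choose F hF1 hF2 using fun n : ℕ => h (1 / (n + 1)) (by positivity) (by
    rw [div_le_one (by positivity)]
    linarith [(n.cast_nonneg : (0 : ℝ) ≤ n)])
  have main : ∀ (n : ℕ), ∀ j ∈ F n, ∀ᵐ ω ∂P,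
      (∀ r : ℝ, 0 < r → ∃ i i', d j i < 2 / (n + 1) ∧ d j i' < 2 / (n + 1) ∧
        0 < d i i' ∧ d i i' < r) →
      ¬ ∃ M : ℝ, ∀ i i', d j i < 2 / (n + 1) → d j i' < 2 / (n + 1) →
        |X i ω - X i' ω| ≤ M * d i i' ^ β := by
    intro n j _
    by_cases hr : ∀ r : ℝ, 0 < r → ∃ i i', d j i < 2 / (n + 1) ∧ d j i' < 2 / (n + 1) ∧
        0 < d i i' ∧ d i i' < r
    · choose u v hu hv hpos hlt using fun m : ℕ => hr (1 / (m + 1)) (by positivity)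
      have hlim : Tendsto (fun m => d (u m) (v m)) atTop (𝓝 0) :=
        squeeze_zero (fun m => (hpos m).le) (fun m => (hlt m).le)
          tendsto_one_div_add_atTop_nhds_zero_nat
      filter_upwards [hX.ae_not_forall_increment_le hd hH0 hH hβ hpos hlim] with ω hω _
      rintro ⟨M, hM⟩
      exact hω ⟨M, fun m => hM _ _ (hu m) (hv m)⟩
    · exact ae_of_all _ fun ω h => absurd h hr
  have main2 := ae_all_iff.2 fun n =>
    (ae_ball_iff (μ := P) (F n).countable_toSet).2 (fun j hj => main n j hj)
  filter_upwards [main2] with ω hω i₀ hacc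
  rintro ⟨r, hr, M, hM0, hM⟩
  obtain ⟨n, hn⟩ := exists_nat_gt (3 / r)
  have hn1 : (0 : ℝ) < n + 1 := by positivity
  have h3 : 3 / ((n : ℝ) + 1) < r := by
    rw [div_lt_iff₀ hr] at hn
    rw [div_lt_iff₀ hn1]
    nlinarith
  obtain ⟨j, hj, hij⟩ := hF2 n i₀ (Set.mem_univ _)
  have e3 : 3 / ((n : ℝ) + 1) = 1 / (n + 1) + 2 / (n + 1) := by ring
  have e2 : 2 / ((n : ℝ) + 1) = 1 / (n + 1) + 1 / (n + 1) := by ring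
  have hp1 : 0 < 1 / ((n : ℝ) + 1) := by positivity
  have hji := hij
  rw [hd.symm] at hji
  refine hω n j hj (fun s hs => ?_) ⟨M, fun i i' hi hi' => hM i ?_ i' ?_⟩
  · obtain ⟨i, hi0, hi⟩ := hacc (min s (1 / (n + 1))) (by positivity)
    have hi1 := hi.trans_le (min_le_left _ _)
    have hi2 := hi.trans_le (min_le_right _ _)
    exact ⟨i₀, i, by linarith, by have := hd.triangle j i₀ i; linarith, hi0, hi1⟩
  · have := hd.triangle i₀ j i
    exact (by linarith : d i₀ i < r)
  · have := hd.triangle i₀ j i'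
    exact (by linarith : d i₀ i' < r)

/-- If every small ball centered in `A` contains two points at distance comparable to its radius,
then almost surely the field is nowhere more than `H`-regular on `A`. -/
lemma ae_forall_not_ptHolderAt (hX : IsFractionalField d φ H X P) (hd : IsPseudoDist d)
    (hH0 : 0 < H) (hH : H ≤ 1 / 2) (hβ : H < β) (hA : PolyCovering d A) {c ρ₀ : ℝ} (hc : 0 < c)
    (hρ₀ : 0 < ρ₀) (hpair : ∀ i ∈ A, ∀ ρ, 0 < ρ → ρ < ρ₀ →
      ∃ u v, d i u < ρ ∧ d i v < ρ ∧ c * ρ ≤ d u v) :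
    ∀ᵐ ω ∂P, ∀ i ∈ A, ¬ PtHolderAt d (fun i => X i ω) i β := by
  obtain ⟨C, q, hC, hnet⟩ := hA.exists_subset hd
  -- With `K (β - H) > q + 1`, a product of `K` factors of order `a ^ (n (β - H))` absorbs the `a ^
  -- (-n q)` net points and leaves a summable `a ^ n`.
  obtain ⟨K, hK⟩ := exists_nat_gt ((q + 1) / (β - H))
  have hγ : 0 < β - H := sub_pos.2 hβ
  have hβ0 : 0 < β := hH0.trans hβ
  rw [div_lt_iff₀ hγ] at hK
  have hK0 : 0 < (K : ℝ) := by
    by_contra! h0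
    have : (0 : ℝ) < q + 1 := by positivity
    nlinarith
  -- `R` is the ratio of consecutive scales. A pair at scale `ρ` has distance in `[c ρ, 2 ρ]`, hence
  -- the factor `2 / c`.
  obtain ⟨R, hR2, hRsep⟩ : ∃ R : ℝ, 2 ≤ R ∧ (2 / c * R⁻¹) ^ H ≤ 1 / (2 * K) := by
    have h1 : Tendsto (fun R : ℝ => (2 / c * R⁻¹) ^ H) atTop (𝓝 0) := by
      have := (tendsto_inv_atTop_zero.const_mul (2 / c)).rpow_const (p := H) (Or.inr hH0.le)
      rwa [mul_zero, Real.zero_rpow hH0.ne'] at this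
    have h2 := h1.eventually (ge_mem_nhds (show (0 : ℝ) < 1 / (2 * K) by positivity))
    exact ((eventually_ge_atTop 2).and h2).exists
  have hR0 : 0 < R := by linarith
  set a : ℝ := R⁻¹ with ha
  have ha0 : 0 < a := inv_pos.2 hR0
  have ha1 : a < 1 := inv_lt_one_of_one_lt₀ (by linarith)
  have hpow1 : ∀ n : ℕ, a ^ n ≤ 1 := fun n => pow_le_one₀ ha0.le ha1.le
  choose F hFA hFcard hFcov using fun n : ℕ => hnet (a ^ n) (by positivity) (hpow1 n)
  have hpair' : ∀ i ρ, ∃ u v, i ∈ A → 0 < ρ → ρ < ρ₀ → d i u < ρ ∧ d i v < ρ ∧ c * ρ ≤ d u v := by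
    intro i ρ
    by_cases h : i ∈ A ∧ 0 < ρ ∧ ρ < ρ₀
    · obtain ⟨u, v, huv⟩ := hpair i h.1 ρ h.2.1 h.2.2
      exact ⟨u, v, fun _ _ _ => huv⟩
    · exact ⟨i, i, fun h1 h2 h3 => absurd ⟨h1, h2, h3⟩ h⟩
  choose u v huv using hpair'
  -- The shift by `n₁` places all scales below `ρ₀`, where pairs exist.
  obtain ⟨n₁, hn₁⟩ := exists_pow_lt_of_lt_one hρ₀ ha1
  have hsmall : ∀ n, a ^ (n + n₁) < ρ₀ := fun n =>
    (pow_le_pow_of_le_one ha0.le ha1.le (Nat.le_add_left _ _)).trans_lt hn₁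
  -- The net has radius `a ^ (n + n₁ + K)`, finer than the `K` scales tested. A pair chosen around a
  -- net point near `i` therefore lies in the doubled ball around `i`, which explains the factor
  -- `2`.
  set bad : ℕ → ℕ → Set Ω := fun M n => ⋃ w ∈ F (n + n₁ + K),
    {ω | ∀ l : Fin K, |X (u w (a ^ (n + n₁ + l))) ω - X (v w (a ^ (n + n₁ + l))) ω| ≤
      (M + 1 : ℝ) * (2 * a ^ (n + n₁ + l)) ^ β} with hbad
  have hmain : ∀ M : ℕ, ∀ᵐ ω ∂P, ∀ᶠ n in atTop, ω ∉ bad M n := by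
    intro M
    set B : ℝ := 3 * ((M + 1) * 2 ^ β / c ^ H) with hB
    have hB0 : 0 < B := by positivity
    have hone : ∀ n, ∀ w ∈ F (n + n₁ + K),
        P.real {ω | ∀ l : Fin K, |X (u w (a ^ (n + n₁ + l))) ω - X (v w (a ^ (n + n₁ + l))) ω| ≤
          (M + 1 : ℝ) * (2 * a ^ (n + n₁ + l)) ^ β} ≤ (B * (a ^ (n + n₁)) ^ (β - H)) ^ K := by
      intro n w hw
      have hwA := hFA _ w hw
      have hlt : ∀ l : ℕ, a ^ (n + n₁ + l) < ρ₀ := fun l => by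
        have := hsmall (n + l)
        rwa [show n + l + n₁ = n + n₁ + l by ring] at this
      have hp : ∀ l : ℕ, 0 < a ^ (n + n₁ + l) := fun l => by positivity
      have hw3 := fun l : ℕ => huv w (a ^ (n + n₁ + l)) hwA (hp l) (hlt l)
      have hlow : ∀ l : ℕ, c * a ^ (n + n₁ + l) ≤
          d (u w (a ^ (n + n₁ + l))) (v w (a ^ (n + n₁ + l))) := fun l => (hw3 l).2.2
      have hupp : ∀ l : ℕ, d (u w (a ^ (n + n₁ + l))) (v w (a ^ (n + n₁ + l))) ≤
          2 * a ^ (n + n₁ + l) := fun l => by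
        have h1 := hd.triangle (u w (a ^ (n + n₁ + l))) w (v w (a ^ (n + n₁ + l)))
        have h2 := (hw3 l).1
        have h3 := (hw3 l).2.1
        rw [hd.symm] at h2
        linarith
      have hpos : ∀ l : ℕ, 0 < d (u w (a ^ (n + n₁ + l))) (v w (a ^ (n + n₁ + l))) := fun l =>
        (mul_pos hc (hp l)).trans_le (hlow l)
      refine (hX.measureReal_forall_increment_le hd hH0 hH (K := K)
        (u := fun l => u w (a ^ (n + n₁ + l))) (v := fun l => v w (a ^ (n + n₁ + l)))
        (fun l => hpos l) (fun l l' hl => ?_)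
        (e := fun l => (M + 1 : ℝ) * (2 * a ^ (n + n₁ + l)) ^ β)
        (fun l => by have := hp l; positivity)).trans ?_
      · refine le_trans (Real.rpow_le_rpow (div_nonneg (hd.nonneg _ _) (hd.nonneg _ _)) ?_ hH0.le)
          hRsep
        rw [div_le_iff₀ (hpos l)]
        have hl' : (l : ℕ) + 1 ≤ l' := hl
        calc _ ≤ 2 * a ^ (n + n₁ + l') := hupp l'
          _ ≤ 2 * a ^ (n + n₁ + (l + 1)) := by
              refine mul_le_mul_of_nonneg_left (pow_le_pow_of_le_one ha0.le ha1.le ?_) zero_le_two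
              omega
          _ = 2 / c * a * (c * a ^ (n + n₁ + l)) := by
              field_simp
              ring
          _ ≤ _ := mul_le_mul_of_nonneg_left (hlow l) (by positivity)
      · have hfac : ∀ l ∈ (Finset.univ : Finset (Fin K)),
            3 * ((M + 1 : ℝ) * (2 * a ^ (n + n₁ + l)) ^ β /
              d (u w (a ^ (n + n₁ + l))) (v w (a ^ (n + n₁ + l))) ^ H) ≤
              B * (a ^ (n + n₁)) ^ (β - H) := by
          intro l _
          have hpl := hp l
          calc _ ≤ 3 * ((M + 1 : ℝ) * (2 * a ^ (n + n₁ + l)) ^ β /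
                (c * a ^ (n + n₁ + l)) ^ H) := by
                refine mul_le_mul_of_nonneg_left ?_ (by norm_num)
                refine div_le_div_of_nonneg_left (by positivity) (by positivity) ?_
                exact Real.rpow_le_rpow (by positivity) (hlow l) hH0.le
            _ = B * (a ^ (n + n₁ + l)) ^ (β - H) := by
                rw [Real.mul_rpow zero_le_two hpl.le, Real.mul_rpow hc.le hpl.le,
                  Real.rpow_sub hpl, hB]
                have h1 : (a ^ (n + n₁ + (l : ℕ))) ^ H ≠ 0 := by positivity
                have h2 : c ^ H ≠ 0 := by positivity
                field_simp
            _ ≤ _ := by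
                refine mul_le_mul_of_nonneg_left (Real.rpow_le_rpow hpl.le ?_ hγ.le) hB0.le
                exact pow_le_pow_of_le_one ha0.le ha1.le (Nat.le_add_right _ _)
        refine (Finset.prod_le_prod (fun l _ => ?_) hfac).trans (le_of_eq ?_)
        · have := hp l
          have := Real.rpow_pos_of_pos (hpos l) H
          positivity
        · rw [Finset.prod_const, Finset.card_univ, Fintype.card_fin]
    refine ae_eventually_notMem_of_summable (g := fun n => C * (R ^ K) ^ q * B ^ K * a ^ n) ?_
      fun n => ?_
    · exact (summable_geometric_of_lt_one ha0.le ha1).mul_left _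
    calc P.real (bad M n) ≤ ∑ w ∈ F (n + n₁ + K), P.real {ω | ∀ l : Fin K,
          |X (u w (a ^ (n + n₁ + l))) ω - X (v w (a ^ (n + n₁ + l))) ω| ≤
          (M + 1 : ℝ) * (2 * a ^ (n + n₁ + l)) ^ β} := measureReal_biUnion_finset_le _ _
      _ ≤ ∑ w ∈ F (n + n₁ + K), (B * (a ^ (n + n₁)) ^ (β - H)) ^ K :=
          Finset.sum_le_sum (hone n)
      _ = (F (n + n₁ + K)).card * (B * (a ^ (n + n₁)) ^ (β - H)) ^ K := by
          rw [Finset.sum_const, nsmul_eq_mul]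
      _ ≤ C * ((a ^ (n + n₁ + K))⁻¹) ^ q * (B * (a ^ (n + n₁)) ^ (β - H)) ^ K :=
          mul_le_mul_of_nonneg_right (hFcard _) (by positivity)
      _ = C * (R ^ K) ^ q * B ^ K * ((R ^ (n + n₁)) ^ q * ((a ^ (n + n₁)) ^ (β - H)) ^ K) := by
          rw [ha, ← inv_pow, inv_inv, pow_add R, mul_pow, mul_pow]
          ring
      _ ≤ C * (R ^ K) ^ q * B ^ K * a ^ n := by
          refine mul_le_mul_of_nonneg_left ?_ (by positivity)
          have hx0 : 0 < a ^ (n + n₁) := by positivity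
          calc (R ^ (n + n₁)) ^ q * ((a ^ (n + n₁)) ^ (β - H)) ^ K
              = (R ^ (n + n₁)) ^ q * (a ^ (n + n₁)) ^ (K * (β - H)) := by
                rw [mul_comm (K : ℝ), Real.rpow_mul hx0.le, Real.rpow_natCast]
            _ ≤ (R ^ (n + n₁)) ^ q * (a ^ (n + n₁)) ^ ((q + 1 : ℕ) : ℝ) := by
                refine mul_le_mul_of_nonneg_left ?_ (by positivity)
                refine Real.rpow_le_rpow_of_exponent_ge hx0 (hpow1 _) ?_
                push_cast
                exact hK.le
            _ = a ^ (n + n₁) := by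
                rw [Real.rpow_natCast, pow_succ, ← mul_assoc, ← mul_pow, ← mul_pow, ha,
                  mul_inv_cancel₀ hR0.ne', one_pow, one_pow, one_mul]
            _ ≤ a ^ n := pow_le_pow_of_le_one ha0.le ha1.le (Nat.le_add_right _ _)
  filter_upwards [ae_all_iff.2 hmain] with ω hω i hi
  rintro ⟨r, hr, M, hM0, hM⟩
  obtain ⟨m, hm⟩ := exists_nat_ge M
  have hev : ∀ᶠ n in atTop, 2 * a ^ n < r := by
    have h1 := (tendsto_pow_atTop_nhds_zero_of_lt_one ha0.le ha1).const_mul 2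
    rw [mul_zero] at h1
    exact h1.eventually (gt_mem_nhds hr)
  obtain ⟨n, hn1, hn2⟩ := ((hω m).and hev).exists
  apply hn1
  obtain ⟨w, hw, hiw⟩ := hFcov (n + n₁ + K) i hi
  simp only [hbad, Set.mem_iUnion]
  refine ⟨w, hw, fun l => ?_⟩
  have hp : 0 < a ^ (n + n₁ + (l : ℕ)) := by positivity
  have hlt : a ^ (n + n₁ + (l : ℕ)) < ρ₀ := by
    have := hsmall (n + l)
    rwa [show n + l + n₁ = n + n₁ + l by ring] at this
  obtain ⟨h1, h2, -⟩ := huv w (a ^ (n + n₁ + l)) (hFA _ w hw) hp hlt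
  have h3 : a ^ (n + n₁ + K) ≤ a ^ (n + n₁ + (l : ℕ)) :=
    pow_le_pow_of_le_one ha0.le ha1.le (by have := l.2; omega)
  have h4 : 2 * a ^ (n + n₁ + (l : ℕ)) < r := by
    refine lt_of_le_of_lt (mul_le_mul_of_nonneg_left ?_ zero_le_two) hn2
    exact pow_le_pow_of_le_one ha0.le ha1.le (by omega)
  refine (hM (2 * a ^ (n + n₁ + (l : ℕ))) (by positivity) h4 _ ?_ _ ?_).trans ?_
  · have := hd.triangle i w (u w (a ^ (n + n₁ + l)))
    exact (by linarith : d i (u w (a ^ (n + n₁ + l))) < 2 * a ^ (n + n₁ + (l : ℕ)))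
  · have := hd.triangle i w (v w (a ^ (n + n₁ + l)))
    exact (by linarith : d i (v w (a ^ (n + n₁ + l))) < 2 * a ^ (n + n₁ + (l : ℕ)))
  · exact mul_le_mul_of_nonneg_right (by linarith) (by positivity)

end IsFractionalField

end Lower

/-! ### Regularity of fractional Gaussian fields -/

section Chaining

variable {ι : Type*} [DecidableEq ι] {d : ι → ι → ℝ} {f : ι → ℝ} {D : Set ι} {G : ℕ → Finset ι} {α a : ℝ} {n₀ : ℕ}

/-- Chaining from a point to a nearby point of a net. -/
lemma abs_sub_le_of_chain (hd : IsPseudoDist d) (ha0 : 0 < a) (ha1 : a < 1)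
    (hcov : ∀ n, ∀ i ∈ D, ∃ j ∈ G n, d i j ≤ (1 / 2 : ℝ) ^ n)
    (hinc : ∀ n, n₀ ≤ n → ∀ u ∈ G n ∪ G (n + 1), ∀ v ∈ G n ∪ G (n + 1),
      d u v ≤ 3 * (1 / 2 : ℝ) ^ n → |f u - f v| ≤ a ^ n) {i : ι} (hi : i ∈ D) {m : ℕ}
    (him : ∀ n, m ≤ n → i ∈ G n) (l : ℕ) : ∀ n, n₀ ≤ n → m ≤ n + l → ∀ u ∈ G n,
      d i u ≤ (1 / 2 : ℝ) ^ n → |f i - f u| ≤ a ^ n / (1 - a) := by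
  have h1a : 0 < 1 - a := by linarith
  -- `l` bounds the number of levels left before level `m`, from which `i` itself belongs to the
  -- nets and the chain stops.
  induction l with
  | zero =>
    intro n hn hm u hu hiu
    have hp : 0 < (1 / 2 : ℝ) ^ n := by positivity
    refine (hinc n hn i (Finset.mem_union_left _ (him n hm)) u (Finset.mem_union_left _ hu)
      (by linarith)).trans ?_
    rw [le_div_iff₀ h1a]
    exact mul_le_of_le_one_right (by positivity) (by linarith)
  | succ l ih =>
    intro n hn hm u hu hiu
    obtain ⟨w, hw, hiw⟩ := hcov (n + 1) i hi
    have h1 := ih (n + 1) (by omega) (by omega) w hw hiw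
    have h2 : |f w - f u| ≤ a ^ n := by
      refine hinc n hn w (Finset.mem_union_right _ hw) u (Finset.mem_union_left _ hu) ?_
      have h3 := hd.triangle w i u
      rw [hd.symm w i] at h3
      have h4 : (1 / 2 : ℝ) ^ (n + 1) ≤ (1 / 2 : ℝ) ^ n :=
        pow_le_pow_of_le_one (by norm_num) (by norm_num) (Nat.le_succ n)
      have hp : 0 < (1 / 2 : ℝ) ^ n := by positivity
      linarith
    calc |f i - f u| ≤ |f i - f w| + |f w - f u| := abs_sub_le _ _ _
      _ ≤ a ^ (n + 1) / (1 - a) + a ^ n := add_le_add h1 h2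
      _ = a ^ n / (1 - a) := by
        field_simp
        ring

/-- The chaining argument: control of the increments along a sequence of nets yields Hölder
continuity. -/
lemma abs_sub_le_rpow_of_chain (hd : IsPseudoDist d) (hα : 0 < α)
    (hcov : ∀ n, ∀ i ∈ D, ∃ j ∈ G n, d i j ≤ (1 / 2 : ℝ) ^ n)
    (hmem : ∀ i ∈ D, ∃ m, ∀ n, m ≤ n → i ∈ G n)
    (hinc : ∀ n, n₀ ≤ n → ∀ u ∈ G n ∪ G (n + 1), ∀ v ∈ G n ∪ G (n + 1),
      d u v ≤ 3 * (1 / 2 : ℝ) ^ n → |f u - f v| ≤ ((1 / 2 : ℝ) ^ α) ^ n) :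
    ∃ M : ℝ, 0 ≤ M ∧ ∀ i ∈ D, ∀ j ∈ D, d i j < (1 / 2 : ℝ) ^ n₀ → |f i - f j| ≤ M * d i j ^ α := by
  set a : ℝ := (1 / 2 : ℝ) ^ α with ha
  have ha0 : 0 < a := by positivity
  have ha1 : a < 1 := Real.rpow_lt_one (by norm_num) (by norm_num) hα
  have h1a : 0 < 1 - a := by linarith
  have apow : ∀ n : ℕ, ((1 / 2 : ℝ) ^ n) ^ α = a ^ n := fun n => by
    rw [ha, ← Real.rpow_natCast, ← Real.rpow_natCast, ← Real.rpow_mul (by norm_num),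
      ← Real.rpow_mul (by norm_num), mul_comm]
  have key : ∀ n, n₀ ≤ n → ∀ i ∈ D, ∀ j ∈ D, d i j ≤ (1 / 2 : ℝ) ^ n →
      |f i - f j| ≤ 3 / (1 - a) * a ^ n := by
    intro n hn i hi j hj hij
    obtain ⟨u, hu, hiu⟩ := hcov n i hi
    obtain ⟨v, hv, hjv⟩ := hcov n j hj
    obtain ⟨m, hm⟩ := hmem i hi
    obtain ⟨m', hm'⟩ := hmem j hj
    have h1 := abs_sub_le_of_chain hd ha0 ha1 hcov hinc hi hm m n hn (by omega) u hu hiu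
    have h2 := abs_sub_le_of_chain hd ha0 ha1 hcov hinc hj hm' m' n hn (by omega) v hv hjv
    have h3 : |f u - f v| ≤ a ^ n := by
      refine hinc n hn u (Finset.mem_union_left _ hu) v (Finset.mem_union_left _ hv) ?_
      have h4 := hd.triangle u i v
      have h5 := hd.triangle i j v
      rw [hd.symm u i] at h4
      linarith
    have h4 : a ^ n ≤ a ^ n / (1 - a) := by
      rw [le_div_iff₀ h1a]
      exact mul_le_of_le_one_right (by positivity) (by linarith)
    rw [abs_sub_comm] at h2
    have h5 := abs_sub_le (f i) (f u) (f j)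
    have h6 := abs_sub_le (f u) (f v) (f j)
    have h7 : 3 / (1 - a) * a ^ n = a ^ n / (1 - a) + a ^ n / (1 - a) + a ^ n / (1 - a) := by ring
    linarith
  -- The two chains and the link between them give `3 / (1 - a)`; dividing by `a` pays for comparing
  -- `2 ^ (-n)` with a distance known only to exceed `2 ^ (-(n + 1))`.
  refine ⟨3 / (1 - a) / a, by positivity, fun i hi j hj hij => ?_⟩
  -- For a pseudo-distance, distinct points may be at distance zero; the estimate at all levels then
  -- forces equal values.
  rcases (hd.nonneg i j).eq_or_lt with h0 | hpos
  · rw [← h0, Real.zero_rpow hα.ne', mul_zero]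
    have ht : Tendsto (fun n : ℕ => 3 / (1 - a) * a ^ n) atTop (𝓝 0) := by
      have := (tendsto_pow_atTop_nhds_zero_of_lt_one ha0.le ha1).const_mul (3 / (1 - a))
      rwa [mul_zero] at this
    refine ge_of_tendsto ht ?_
    filter_upwards [eventually_ge_atTop n₀] with n hn
    exact key n hn i hi j hj (by rw [← h0]; positivity)
  · have hle1 : (1 / 2 : ℝ) ^ n₀ ≤ 1 := pow_le_one₀ (by norm_num) (by norm_num)
    obtain ⟨n, hn1, hn2⟩ := exists_nat_pow_near_of_lt_one hpos (hij.le.trans hle1)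
      (show (0 : ℝ) < 1 / 2 by norm_num) (by norm_num)
    have hn : n₀ ≤ n := by
      have h1 := hn1.trans hij
      rw [pow_lt_pow_iff_right_of_lt_one₀ (by norm_num) (by norm_num)] at h1
      omega
    refine (key n hn i hi j hj hn2).trans ?_
    have h2 : a ^ (n + 1) ≤ d i j ^ α := by
      rw [← apow]
      exact Real.rpow_le_rpow (by positivity) hn1.le hα.le
    calc 3 / (1 - a) * a ^ n = 3 / (1 - a) / a * a ^ (n + 1) := by
          rw [pow_succ]
          field_simp
      _ ≤ _ := mul_le_mul_of_nonneg_left h2 (by positivity)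

end Chaining

section Upper

variable {Ω : Type*} [MeasurableSpace Ω] {P : Measure Ω} [IsProbabilityMeasure P]
  {ι : Type*} {d : ι → ι → ℝ} {φ : ι → ℝ} {H α : ℝ} {X : ι → Ω → ℝ} {A : Set ι}

/-- `exp (-c θ ^ n)` decays faster than any geometric sequence when `θ > 1`. -/
lemma exists_exp_neg_mul_pow_le {c θ B : ℝ} (hc : 0 < c) (hθ : 1 < θ) (hB : 0 < B) :
    ∃ C : ℝ, 0 ≤ C ∧ ∀ n : ℕ, B ^ n * Real.exp (-(c * θ ^ n)) ≤ C * (1 / 2) ^ n := by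
  -- Only the `k`-th term of the exponential series is needed, with `k` such that `θ ^ k` exceeds
  -- `2B`.
  obtain ⟨k, hk⟩ := pow_unbounded_of_one_lt (2 * B) hθ
  refine ⟨k.factorial / c ^ k, by positivity, fun n => ?_⟩
  have hθ0 : 0 < θ := by linarith
  have h1 : (c * θ ^ n) ^ k / k.factorial ≤ Real.exp (c * θ ^ n) :=
    Real.pow_div_factorial_le_exp _ (by positivity) k
  have h2 : Real.exp (-(c * θ ^ n)) ≤ k.factorial / (c ^ k * (θ ^ k) ^ n) := by
    rw [Real.exp_neg, inv_le_comm₀ (Real.exp_pos _) (by positivity), inv_div]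
    refine le_trans (le_of_eq ?_) h1
    rw [mul_pow, ← pow_mul, ← pow_mul, mul_comm n k]
  calc B ^ n * Real.exp (-(c * θ ^ n)) ≤ B ^ n * (k.factorial / (c ^ k * (2 * B) ^ n)) := by
        refine mul_le_mul_of_nonneg_left (h2.trans ?_) (by positivity)
        refine div_le_div_of_nonneg_left (by positivity) (by positivity) ?_
        exact mul_le_mul_of_nonneg_left (pow_le_pow_left₀ (by positivity) hk.le n) (by positivity)
    _ = _ := by
        rw [mul_pow, div_pow, one_pow]
        field_simp

namespace IsFractionalField

/-- Kolmogorov–Chentsov chaining. Countability of `D` makes every chain finite, so no continuity of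
the paths is presupposed. -/
lemma ae_holderOn_of_countable (hX : IsFractionalField d φ H X P) (hd : IsPseudoDist d)
    (hH0 : 0 < H) (hα : 0 < α) (hαH : α < H) (hA : PolyCovering d A) {D : Set ι}
    (hD : D.Countable) (hDA : D ⊆ A) :
    ∀ᵐ ω ∂P, ∃ δ : ℝ, 0 < δ ∧ ∃ M : ℝ, 0 ≤ M ∧ ∀ i ∈ D, ∀ j ∈ D, d i j < δ →
      |X i ω - X j ω| ≤ M * d i j ^ α := by
  classical
  rcases D.eq_empty_or_nonempty with rfl | hne
  · exact ae_of_all _ fun ω => ⟨1, one_pos, 0, le_rfl, by simp⟩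
  obtain ⟨e, he⟩ := hD.exists_eq_range hne
  obtain ⟨C, q, hC, hnet⟩ := hA
  choose F hFcard hFcov using fun n : ℕ => hnet ((1 / 2) ^ n) (by positivity)
    (pow_le_one₀ (by norm_num) (by norm_num))
  -- Adding the first `n + 1` points of an enumeration puts each point of `D` in all sufficiently
  -- fine nets, while the cardinality stays geometric.
  set G : ℕ → Finset ι := fun n => F n ∪ (Finset.range (n + 1)).image e with hG
  have hGcov : ∀ n, ∀ i ∈ D, ∃ j ∈ G n, d i j ≤ (1 / 2 : ℝ) ^ n := fun n i hi => by
    obtain ⟨j, hj, hij⟩ := hFcov n i (hDA hi)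
    exact ⟨j, Finset.mem_union_left _ hj, hij⟩
  have hGmem : ∀ i ∈ D, ∃ m, ∀ n, m ≤ n → i ∈ G n := fun i hi => by
    rw [he] at hi
    obtain ⟨m, rfl⟩ := hi
    exact ⟨m, fun n hn => Finset.mem_union_right _
      (Finset.mem_image_of_mem _ (Finset.mem_range.2 (by omega)))⟩
  have hGcard : ∀ n, ((G n).card : ℝ) ≤ (C + 1) * (2 ^ (q + 1)) ^ n := fun n => by
    have h1 : ((G n).card : ℝ) ≤ (F n).card + (n + 1) := by
      have h2 : (G n).card ≤ (F n).card + (n + 1) :=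
        (Finset.card_union_le _ _).trans
          (Nat.add_le_add_left (Finset.card_image_le.trans (by simp)) _)
      exact_mod_cast h2
    have h3 : ((n : ℝ) + 1) ≤ 2 ^ n := by
      exact_mod_cast Nat.lt_two_pow_self (n := n)
    have h4 := hFcard n
    rw [← inv_pow, one_div, inv_inv, ← pow_mul] at h4
    have h5 : (2 : ℝ) ^ (n * q) ≤ (2 ^ (q + 1)) ^ n := by
      rw [← pow_mul]
      exact pow_le_pow_right₀ one_le_two (by nlinarith)
    have h6 : (2 : ℝ) ^ n ≤ (2 ^ (q + 1)) ^ n := by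
      rw [← pow_mul]
      exact pow_le_pow_right₀ one_le_two (by nlinarith)
    nlinarith
  set b : ℝ := 2 ^ (q + 1) with hb
  have hb1 : 1 ≤ b := one_le_pow₀ one_le_two
  set U : ℕ → Finset ι := fun n => G n ∪ G (n + 1) with hU
  have hUcard : ∀ n, ((U n).card : ℝ) ≤ (C + 1) * (1 + b) * b ^ n := fun n => by
    have h1 : ((U n).card : ℝ) ≤ (G n).card + (G (n + 1)).card := by
      exact_mod_cast Finset.card_union_le _ _
    have h2 := hGcard n
    have h3 := hGcard (n + 1)
    rw [pow_succ] at h3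
    calc _ ≤ _ := h1
      _ ≤ _ := add_le_add h2 h3
      _ = _ := by ring
  set a : ℝ := (1 / 2 : ℝ) ^ α with ha
  have ha0 : 0 < a := by positivity
  set h : ℝ := (1 / 2 : ℝ) ^ H with hh
  have hh0 : 0 < h := by positivity
  have hha : h < a := Real.rpow_lt_rpow_of_exponent_gt (by norm_num) (by norm_num) hαH
  set bad : ℕ → Set Ω := fun n => ⋃ p ∈ (U n ×ˢ U n).filter
    (fun p => d p.1 p.2 ≤ 3 * (1 / 2 : ℝ) ^ n), {ω | a ^ n ≤ |X p.1 ω - X p.2 ω|} with hbad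
  set c : ℝ := 1 / (2 * 3 ^ (2 * H)) with hc
  -- The threshold is `a ^ n` and the standard deviation is of order `h ^ n`, so the Gaussian
  -- exponent grows like `θ ^ n`; `θ > 1` because `α < H`.
  set θ : ℝ := (a / h) ^ 2 with hθ
  have hθ1 : 1 < θ := by
    rw [hθ]
    exact one_lt_pow₀ ((one_lt_div hh0).2 hha) two_ne_zero
  have hone : ∀ n (p : ι × ι), d p.1 p.2 ≤ 3 * (1 / 2 : ℝ) ^ n →
      P.real {ω | a ^ n ≤ |X p.1 ω - X p.2 ω|} ≤ 2 * Real.exp (-(c * θ ^ n)) := by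
    intro n p hp
    refine (hX.measureReal_le_abs_increment hd hH0 hp (by positivity)).trans (le_of_eq ?_)
    congr 2
    have h1 : (3 * (1 / 2 : ℝ) ^ n) ^ (2 * H) = 3 ^ (2 * H) * (h ^ n) ^ 2 := by
      rw [Real.mul_rpow (by norm_num) (by positivity)]
      rw [hh, Real.rpow_pow_comm (by norm_num), mul_comm 2 H,
        Real.rpow_mul (x := (1 / 2 : ℝ) ^ n) (by positivity), Real.rpow_two]
    have h2 : θ ^ n = (a ^ n) ^ 2 / (h ^ n) ^ 2 := by
      rw [hθ, div_pow, div_pow, ← pow_mul, ← pow_mul, mul_comm 2 n, pow_mul, pow_mul]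
    rw [h1, hc, h2]
    have h3 : (3 : ℝ) ^ (2 * H) ≠ 0 := by positivity
    field_simp
  obtain ⟨C', hC', hdecay⟩ := exists_exp_neg_mul_pow_le (c := c) (θ := θ) (B := b ^ 2)
    (by positivity) hθ1 (by positivity)
  have hbadP : ∀ n, P.real (bad n) ≤
      ((C + 1) * (1 + b)) ^ 2 * 2 * C' * (1 / 2) ^ n := by
    intro n
    calc P.real (bad n) ≤ ∑ p ∈ (U n ×ˢ U n).filter
          (fun p => d p.1 p.2 ≤ 3 * (1 / 2 : ℝ) ^ n), P.real {ω | a ^ n ≤ |X p.1 ω - X p.2 ω|} :=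
          measureReal_biUnion_finset_le _ _
      _ ≤ ∑ p ∈ (U n ×ˢ U n).filter (fun p => d p.1 p.2 ≤ 3 * (1 / 2 : ℝ) ^ n),
          2 * Real.exp (-(c * θ ^ n)) :=
          Finset.sum_le_sum fun p hp => hone n p (Finset.mem_filter.1 hp).2
      _ ≤ ((U n).card : ℝ) ^ 2 * (2 * Real.exp (-(c * θ ^ n))) := by
          rw [Finset.sum_const, nsmul_eq_mul]
          refine mul_le_mul_of_nonneg_right ?_ (by positivity)
          have h1 := Finset.card_filter_le (U n ×ˢ U n)
            (fun p => d p.1 p.2 ≤ 3 * (1 / 2 : ℝ) ^ n)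
          rw [Finset.card_product] at h1
          rw [sq]
          exact_mod_cast h1
      _ ≤ ((C + 1) * (1 + b) * b ^ n) ^ 2 * (2 * Real.exp (-(c * θ ^ n))) := by
          refine mul_le_mul_of_nonneg_right ?_ (by positivity)
          exact pow_le_pow_left₀ (by positivity) (hUcard n) 2
      _ = ((C + 1) * (1 + b)) ^ 2 * 2 * ((b ^ 2) ^ n * Real.exp (-(c * θ ^ n))) := by
          rw [mul_pow _ (b ^ n), ← pow_mul b n 2, mul_comm n 2, pow_mul]
          ring
      _ ≤ ((C + 1) * (1 + b)) ^ 2 * 2 * (C' * (1 / 2) ^ n) :=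
          mul_le_mul_of_nonneg_left (hdecay n) (by positivity)
      _ = _ := by ring
  have hsum : Summable fun n : ℕ => ((C + 1) * (1 + b)) ^ 2 * 2 * C' * (1 / 2 : ℝ) ^ n :=
    summable_geometric_two.mul_left _
  filter_upwards [ae_eventually_notMem_of_summable hsum hbadP] with ω hω
  obtain ⟨n₀, hn₀⟩ := eventually_atTop.1 hω
  obtain ⟨M, hM0, hM⟩ := abs_sub_le_rpow_of_chain (f := fun i => X i ω) hd hα hGcov hGmem
    (n₀ := n₀) (fun n hn u hu v hv huv => by
      by_contra! hlt
      apply hn₀ n hn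
      simp only [hbad, Set.mem_iUnion]
      exact ⟨(u, v), Finset.mem_filter.2 ⟨Finset.mk_mem_product hu hv, huv⟩, hlt.le⟩)
  exact ⟨(1 / 2) ^ n₀, by positivity, M, hM0, hM⟩

/-- A separable fractional Gaussian field is almost surely `α`-Hölder around every interior point
of a polynomially covered set, for every `α < H`. -/
lemma ae_forall_locHolderAt (hX : IsFractionalField d φ H X P) (hd : IsPseudoDist d)
    (hsep : IsSeparableProcess d X P) (hH0 : 0 < H) (hα : 0 < α) (hαH : α < H)
    (hA : PolyCovering d A) :
    ∀ᵐ ω ∂P, ∀ i₀, (∃ r : ℝ, 0 < r ∧ openBall d i₀ r ⊆ A) →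
      LocHolderAt d (fun i => X i ω) i₀ α := by
  obtain ⟨S, Λ, hS, hΛ, hFO⟩ := hsep
  have hΛ' : ∀ᵐ ω ∂P, ω ∉ Λ := measure_eq_zero_iff_ae_notMem.1 hΛ
  have hopen : ∀ i r, IsOpenFor d (openBall d i r) := by
    intro i r j hj
    have hj : d i j < r := hj
    refine ⟨r - d i j, by linarith, fun k hk => ?_⟩
    have hk : d j k < r - d i j := hk
    have := hd.triangle i j k
    exact (by linarith : d i k < r)
  filter_upwards [hΛ', hX.ae_holderOn_of_countable hd hH0 hα hαH hA
    (hS.mono Set.inter_subset_left) (Set.inter_subset_right (s := S) (t := A))] with ω hω hhol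
  obtain ⟨δ, hδ, M, hM0, hM⟩ := hhol
  have happrox : ∀ i : ι, ∀ ε : ℝ, 0 < ε → ∃ s ∈ S, d i s < ε ∧ |X s ω - X i ω| < ε := by
    intro i ε hε
    -- Separability is tested on the closure of the values over `S` in the ball, a closed set that
    -- may depend on `ω` because the null set `Λ` serves all closed sets at once.
    set F : Set ℝ := closure ((fun s => X s ω) '' (openBall d i ε ∩ S)) with hF
    have h1 : ω ∉ {ω | ∀ j ∈ openBall d i ε ∩ S, X j ω ∈ F} \
        {ω | ∀ j ∈ openBall d i ε, X j ω ∈ F} := fun h => hω (hFO F _ isClosed_closure (hopen _ _) h)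
    have h2 : ω ∈ {ω | ∀ j ∈ openBall d i ε, X j ω ∈ F} := by
      by_contra h3
      exact h1 ⟨fun j hj => subset_closure (Set.mem_image_of_mem _ hj), h3⟩
    have h4 : X i ω ∈ F := h2 i (by
      have : d i i < ε := by rwa [hd.self]
      exact this)
    obtain ⟨y, ⟨s, hs, rfl⟩, hy⟩ := Metric.mem_closure_iff.1 h4 ε hε
    refine ⟨s, hs.2, hs.1, ?_⟩
    rw [dist_comm, Real.dist_eq] at hy
    exact hy
  intro i₀ hi₀
  obtain ⟨r, hr, hrA⟩ := hi₀
  -- This leaves room for approximants in `S`: they remain in `A`, and their mutual distance stays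
  -- below `δ`.
  refine ⟨min (r / 2) (δ / 4), by positivity, M, hM0, fun i hi j hj => ?_⟩
  have hi1 : d i₀ i < r / 2 := lt_of_lt_of_le hi (min_le_left _ _)
  have hi2 : d i₀ i < δ / 4 := lt_of_lt_of_le hi (min_le_right _ _)
  have hj1 : d i₀ j < r / 2 := lt_of_lt_of_le hj (min_le_left _ _)
  have hj2 : d i₀ j < δ / 4 := lt_of_lt_of_le hj (min_le_right _ _)
  have hbound : ∀ᶠ ε in 𝓝[>] (0 : ℝ), |X i ω - X j ω| ≤ 2 * ε + M * (d i j + 2 * ε) ^ α := by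
    filter_upwards [Ioo_mem_nhdsGT (show 0 < min (r / 2) (δ / 4) by positivity)] with ε hε
    have hε1 := hε.2.trans_le (min_le_left _ _)
    have hε2 := hε.2.trans_le (min_le_right _ _)
    obtain ⟨s, hs, his, hXs⟩ := happrox i ε hε.1
    obtain ⟨t, ht, hjt, hXt⟩ := happrox j ε hε.1
    have hsA : s ∈ A := hrA (by
      have := hd.triangle i₀ i s
      exact (by linarith : d i₀ s < r))
    have htA : t ∈ A := hrA (by
      have := hd.triangle i₀ j t
      exact (by linarith : d i₀ t < r))
    have hst : d s t ≤ d i j + 2 * ε := by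
      have h1 := hd.triangle s i t
      have h2 := hd.triangle i j t
      rw [hd.symm s i] at h1
      linarith
    have hij : d i j < δ / 2 := by
      have h1 := hd.triangle i i₀ j
      rw [hd.symm i i₀] at h1
      linarith
    have h3 := hM s ⟨hs, hsA⟩ t ⟨ht, htA⟩ (by linarith)
    have h4 : d s t ^ α ≤ (d i j + 2 * ε) ^ α := Real.rpow_le_rpow (hd.nonneg _ _) hst hα.le
    have h5 := mul_le_mul_of_nonneg_left h4 hM0
    have h6 := abs_sub_le (X i ω) (X s ω) (X j ω)
    have h7 := abs_sub_le (X s ω) (X t ω) (X j ω)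
    rw [abs_sub_comm] at hXs
    linarith
  have hlim : Tendsto (fun ε : ℝ => 2 * ε + M * (d i j + 2 * ε) ^ α) (𝓝[>] 0)
      (𝓝 (M * d i j ^ α)) := by
    have hcont : Continuous fun ε : ℝ => 2 * ε + M * (d i j + 2 * ε) ^ α :=
      (continuous_const.mul continuous_id).add (continuous_const.mul
        ((continuous_const.add (continuous_const.mul continuous_id)).rpow_const
          fun _ => Or.inr hα.le))
    have h1 := hcont.tendsto 0
    simp only [mul_zero, add_zero, zero_add] at h1
    exact h1.mono_left nhdsWithin_le_nhds
  exact ge_of_tendsto hlim hbound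

end IsFractionalField

end Upper

/-! ### Hölder exponents of fractional Gaussian fields -/

section ExponentsOfFields

variable {Ω : Type*} [MeasurableSpace Ω] {P : Measure Ω} [IsProbabilityMeasure P]
  {ι : Type*} {d d' : ι → ι → ℝ} {φ : ι → ℝ} {H : ℝ} {X : ι → Ω → ℝ}

/-- Every small ball `B(i₀, ρ)` contains two points at distance at least `c ρ`. -/
def HasLargePairs (d : ι → ι → ℝ) (c : ℝ) (i₀ : ι) : Prop :=
  ∃ ρ₀ : ℝ, 0 < ρ₀ ∧ ∀ ρ, 0 < ρ → ρ < ρ₀ → ∃ u v, d i₀ u < ρ ∧ d i₀ v < ρ ∧ c * ρ ≤ d u v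

namespace IsFractionalField

lemma ae_forall_nat_locHolderAt (hX : IsFractionalField d φ H X P) (hd : IsPseudoDist d)
    (hsep : IsSeparableProcess d X P) (hH0 : 0 < H) {A : Set ι} (hA : PolyCovering d A) :
    ∀ᵐ ω ∂P, ∀ n : ℕ, ∀ i₀, (∃ r : ℝ, 0 < r ∧ openBall d i₀ r ⊆ A) →
      LocHolderAt d (fun i => X i ω) i₀ (H * (1 - 1 / (n + 2))) := by
  refine ae_all_iff.2 fun n => ?_
  have h1 : (0 : ℝ) < 1 / (n + 2) := by positivity
  have h2 : (1 : ℝ) / (n + 2) < 1 := by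
    rw [div_lt_one (by positivity)]
    linarith [(n.cast_nonneg : (0 : ℝ) ≤ n)]
  exact hX.ae_forall_locHolderAt hd hsep hH0 (mul_pos hH0 (by linarith)) (by nlinarith) hA

/-- The local Hölder exponent at the non-isolated points of a totally bounded index set. -/
lemma ae_localHolderExponent_eq (hX : IsFractionalField d φ H X P) (hd : IsPseudoDist d)
    (hsep : IsSeparableProcess d X P) (hH0 : 0 < H) (hH : H ≤ 1 / 2)
    (hA : PolyCovering d (Set.univ : Set ι)) (hd' : IsPseudoDist d') (hdd : EquivalentDist d' d) :
    ∀ᵐ ω ∂P, ∀ i₀, (∀ r : ℝ, 0 < r → ∃ i, 0 < d i₀ i ∧ d i₀ i < r) →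
      localHolderExponent d' (fun i => X i ω) i₀ = (H : EReal) := by
  have h2 : ∀ᵐ ω ∂P, ∀ n : ℕ, ∀ i₀, (∀ r : ℝ, 0 < r → ∃ i, 0 < d i₀ i ∧ d i₀ i < r) →
      ¬ LocHolderAt d (fun i => X i ω) i₀ (H * (1 + 1 / (n + 1))) := by
    refine ae_all_iff.2 fun n => ?_
    have h1 : (0 : ℝ) < 1 / (n + 1) := by positivity
    exact hX.ae_forall_not_locHolderAt hd hH0 hH (by nlinarith) hA
  filter_upwards [hX.ae_forall_nat_locHolderAt hd hsep hH0 hA, h2] with ω hω1 hω2 i₀ hi₀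
  exact localHolderExponent_eq hd' hd hdd hH0
    (fun n => hω1 n i₀ ⟨1, one_pos, Set.subset_univ _⟩) (fun n => hω2 n i₀ hi₀)

/-- Both Hölder exponents at the points around which the index set is polynomially covered and
large increments are available. -/
lemma ae_holderExponents_eq (hX : IsFractionalField d φ H X P) (hd : IsPseudoDist d)
    (hsep : IsSeparableProcess d X P) (hH0 : 0 < H) (hH : H ≤ 1 / 2) {A : ℕ → Set ι}
    (hA : ∀ k, PolyCovering d (A k)) (hd' : IsPseudoDist d') (hdd : EquivalentDist d' d)
    {c : ℝ} (hc : 0 < c) :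
    ∀ᵐ ω ∂P, ∀ i₀, (∃ k, ∃ r : ℝ, 0 < r ∧ openBall d i₀ r ⊆ A k) → HasLargePairs d c i₀ →
      pointwiseHolderExponent d' (fun i => X i ω) i₀ = (H : EReal) ∧
      localHolderExponent d' (fun i => X i ω) i₀ = (H : EReal) := by
  have h1 := ae_all_iff.2 fun k => hX.ae_forall_nat_locHolderAt hd hsep hH0 (hA k)
  -- The threshold radius for large pairs depends on the point, so `A k` is exhausted by countably
  -- many subsets on which `1 / (m + 1)` works uniformly.
  have h2 : ∀ᵐ ω ∂P, ∀ (k m n : ℕ), ∀ i ∈ A k ∩ {i | ∀ ρ, 0 < ρ → ρ < 1 / ((m : ℝ) + 1) →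
      ∃ u v, d i u < ρ ∧ d i v < ρ ∧ c * ρ ≤ d u v},
      ¬ PtHolderAt d (fun i => X i ω) i (H * (1 + 1 / (n + 1))) := by
    refine ae_all_iff.2 fun k => ae_all_iff.2 fun m => ae_all_iff.2 fun n => ?_
    have h1 : (0 : ℝ) < 1 / (n + 1) := by positivity
    exact hX.ae_forall_not_ptHolderAt hd hH0 hH (by nlinarith)
      ((hA k).mono Set.inter_subset_left) hc (ρ₀ := 1 / (m + 1)) (by positivity)
      (fun i hi => hi.2)
  filter_upwards [h1, h2] with ω hω1 hω2 i₀ hball hpair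
  obtain ⟨k, r, hr, hrA⟩ := hball
  obtain ⟨ρ₀, hρ₀, hpair⟩ := hpair
  obtain ⟨m, hm⟩ := exists_nat_one_div_lt hρ₀
  have hi₀ : i₀ ∈ A k := hrA (by
    have : d i₀ i₀ < r := by rwa [hd.self]
    exact this)
  have hlo : ∀ n : ℕ, LocHolderAt d (fun i => X i ω) i₀ (H * (1 - 1 / (n + 2))) :=
    fun n => hω1 k n i₀ ⟨r, hr, hrA⟩
  have hup : ∀ n : ℕ, ¬ PtHolderAt d (fun i => X i ω) i₀ (H * (1 + 1 / (n + 1))) :=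
    fun n => hω2 k m n i₀ ⟨hi₀, fun ρ hρ hρm => hpair ρ hρ (hρm.trans hm)⟩
  refine ⟨pointwiseHolderExponent_eq hd hdd hH0 hlo hup,
    localHolderExponent_eq hd' hd hdd hH0 hlo fun n h => hup n (h.ptHolderAt hd ?_)⟩
  positivity

end IsFractionalField

end ExponentsOfFields

/-! ### The pseudo-distance `d_m` -/

section MeasDist

variable {T : Type*} [MeasurableSpace T] {m : Measure T} {𝒜 : Set (Set T)}

/-- Finiteness is needed for the triangle inequality, because `Measure.real` sends infinite measure
to zero. -/
lemma isPseudoDist_measDistOn (hfin : ∀ U ∈ 𝒜, m U ≠ ∞) : IsPseudoDist (measDistOn m 𝒜) where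
  nonneg _ _ := measureReal_nonneg
  self U := by simp [measDistOn, measDist]
  symm U V := by simp [measDistOn, measDist, symmDiff_comm]
  triangle U V W := by
    have hf : ∀ A B : 𝒜, m ((A : Set T) ∆ (B : Set T)) ≠ ∞ := fun A B =>
      ne_top_of_le_ne_top (ENNReal.add_ne_top.2 ⟨hfin A A.2, hfin B B.2⟩)
        ((measure_mono Set.symmDiff_subset_union).trans (measure_union_le _ _))
    exact (measureReal_mono (symmDiff_triangle _ _ _)
      (ne_top_of_le_ne_top (ENNReal.add_ne_top.2 ⟨hf U V, hf V W⟩) (measure_union_le _ _))).trans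
      (measureReal_union_le _ _)

lemma measDist_of_subset {U V : Set T} (h : U ⊆ V) : measDist m U V = m.real (V \ U) := by
  rw [measDist, symmDiff_of_le h]

lemma measDist_comm (U V : Set T) : measDist m U V = measDist m V U := by
  rw [measDist, symmDiff_comm, measDist]

lemma IsSIfBm.isFractionalField {Ω : Type*} [MeasurableSpace Ω] {P : Measure Ω} {H : ℝ}
    {X : 𝒜 → Ω → ℝ} (h : IsSIfBm m 𝒜 H X P) :
    IsFractionalField (measDistOn m 𝒜) (fun U => m.real (U : Set T) ^ (2 * H)) H X P :=
  ⟨h.isGaussian, h.centered, h.covariance⟩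

end MeasDist

/-! ### Geometry of indexing collections -/

section IndexingGeometry

variable {T : Type*} [TopologicalSpace T] {𝒜 : Set (Set T)} {𝒜n : ℕ → Set (Set T)}

lemma subset_interior_outerApprox {ℬ : Set (Set T)} (hℬ : ℬ.Finite) (U : Set T) :
    U ⊆ interior (outerApprox ℬ U) := by
  rw [outerApprox, (hℬ.subset (fun V hV => hV.1)).interior_sInter]
  exact Set.subset_iInter₂ fun V hV => hV.2

lemma subset_outerApprox (ℬ : Set (Set T)) (U : Set T) : U ⊆ outerApprox ℬ U :=
  Set.subset_sInter fun _ hV => hV.2.trans interior_subset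

lemma outerApprox_mono (ℬ : Set (Set T)) {U V : Set T} (h : U ⊆ V) :
    outerApprox ℬ U ⊆ outerApprox ℬ V :=
  Set.sInter_subset_sInter fun _ hW => ⟨hW.1, h.trans hW.2⟩

namespace IsIndexingCollection

lemma inter_mem (hI : IsIndexingCollection 𝒜 𝒜n) {U V : Set T} (hU : U ∈ 𝒜) (hV : V ∈ 𝒜) :
    U ∩ V ∈ 𝒜 := by
  rw [← Set.sInter_pair]
  refine hI.sInter_mem _ ?_ (Set.insert_nonempty _ _)
  rintro W (rfl | rfl)
  exacts [hU, hV]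

/-- A maximal member `V` of `𝒜n 0` above a nonempty one satisfies `g₀(V) = V`, hence is open; the
axiom on interiors then forces `V` to be the whole space. In particular the space is compact. -/
lemma univ_mem (hI : IsIndexingCollection 𝒜 𝒜n) : Set.univ ∈ 𝒜 := by
  obtain ⟨U, hU, hUne⟩ := hI.sub_nonempty_mem 0
  obtain ⟨V, hUV, hV⟩ := (hI.sub_finite 0).exists_le_maximal hU
  have hV𝒜 := hI.sub_subset 0 hV.prop
  have h1 : outerApprox (𝒜n 0) V ⊆ V :=
    hV.le_of_ge (hI.outerApprox_mem 0 V hV𝒜) (subset_outerApprox _ _)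
  have h2 : interior V = V := interior_subset.antisymm
    ((subset_interior_outerApprox (hI.sub_finite 0) V).trans (interior_mono h1))
  by_contra hne
  exact hI.interior_ne V hV𝒜 (hUne.mono hUV).ne_empty (fun h => hne (h ▸ hV𝒜)) h2

lemma sInter_nonempty_mem (hI : IsIndexingCollection 𝒜 𝒜n) :
    ⋂₀ {U | U ∈ 𝒜 ∧ U.Nonempty} ∈ 𝒜 := by
  obtain ⟨U, hU, hUne⟩ := hI.sub_nonempty_mem 0
  exact hI.sInter_mem _ (fun V hV => hV.1) ⟨U, hI.sub_subset 0 hU, hUne⟩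

/-- The nonempty members form a downward directed family of compact sets, by pairwise intersection.
-/
lemma nonempty_sInter_nonempty [T2Space T] (hI : IsIndexingCollection 𝒜 𝒜n) :
    (⋂₀ {U | U ∈ 𝒜 ∧ U.Nonempty}).Nonempty := by
  obtain ⟨U, hU, hUne⟩ := hI.sub_nonempty_mem 0
  have : Nonempty {U | U ∈ 𝒜 ∧ U.Nonempty} := ⟨⟨U, hI.sub_subset 0 hU, hUne⟩⟩
  refine IsCompact.nonempty_sInter_of_directed_nonempty_isCompact_isClosed ?_
    (fun V hV => hV.2) (fun V hV => hI.isCompact V hV.1)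
    (fun V hV => (hI.isCompact V hV.1).isClosed)
  intro V hV W hW
  exact ⟨V ∩ W, ⟨hI.inter_mem hV.1 hW.1, hI.inter_nonempty V hV.1 W hW.1 hV.2 hW.2⟩,
    Set.inter_subset_left, Set.inter_subset_right⟩

/-- Iterating `W ↦ g_n(W) ∩ V` from a nonempty `U ⊆ V` one reaches `V`, by connectedness. -/
lemma exists_iterate_eq [T2Space T] (hI : IsIndexingCollection 𝒜 𝒜n) (n : ℕ) {U V : Set T}
    (hU : U ∈ 𝒜) (hV : V ∈ 𝒜) (hUV : U ⊆ V) (hne : U.Nonempty) :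
    ∃ (W : ℕ → Set T) (K : ℕ), W 0 = U ∧ W K = V ∧ (∀ k, W k ∈ 𝒜 ∧ U ⊆ W k ∧ W k ⊆ V) ∧
      ∀ k, W (k + 1) = outerApprox (𝒜n n) (W k) ∩ V := by
  set W : ℕ → Set T := fun k => (fun W => outerApprox (𝒜n n) W ∩ V)^[k] U with hW
  have hsucc : ∀ k, W (k + 1) = outerApprox (𝒜n n) (W k) ∩ V := fun k => by
    simp only [hW, Function.iterate_succ_apply']
  have hinv : ∀ k, W k ∈ 𝒜 ∧ U ⊆ W k ∧ W k ⊆ V := by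
    intro k
    induction k with
    | zero => exact ⟨hU, subset_rfl, hUV⟩
    | succ k ih =>
      rw [hsucc]
      refine ⟨hI.inter_mem (hI.sub_subset n (hI.outerApprox_mem n _ ih.1)) hV,
        Set.subset_inter (ih.2.1.trans (subset_outerApprox _ _)) hUV, Set.inter_subset_right⟩
  have hmono : Monotone W := monotone_nat_of_le_succ fun k => by
    rw [hsucc]
    exact Set.subset_inter (subset_outerApprox _ _) (hinv k).2.2
  -- Finiteness of `𝒜n n` makes the increasing sequence `g_n(W k)` take a value twice, and
  -- monotonicity makes it constant in between.
  obtain ⟨k, l, hkl, heq⟩ := Set.Finite.exists_lt_map_eq_of_forall_mem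
    (f := fun k => outerApprox (𝒜n n) (W k)) (fun k => hI.outerApprox_mem n _ (hinv k).1)
    (hI.sub_finite n)
  have hstab : outerApprox (𝒜n n) (W (k + 1)) = outerApprox (𝒜n n) (W k) :=
    (le_of_le_of_eq (outerApprox_mono _ (hmono hkl)) heq.symm).antisymm
      (outerApprox_mono _ (hmono (Nat.le_succ k)))
  have hfix : W (k + 1) = outerApprox (𝒜n n) (W (k + 1)) ∩ V := by rw [hstab, ← hsucc]
  refine ⟨W, k + 1, rfl, (hinv _).2.2.antisymm ?_, hinv, hsucc⟩
  by_contra hnot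
  obtain ⟨x, hxV, hxW⟩ := Set.not_subset.1 hnot
  obtain ⟨y, hy⟩ := hne
  have hint := subset_interior_outerApprox (hI.sub_finite n) (W (k + 1))
  -- At the fixed point, the interior of `g_n(W)` and the complement of `W` are open and cover `V`;
  -- if `W ≠ V`, connectedness gives a point of `V` in both, which the fixed-point equation forbids.
  obtain ⟨z, hzV, hz1, hz2⟩ := hI.isPreconnected V hV
    (interior (outerApprox (𝒜n n) (W (k + 1)))) (W (k + 1))ᶜ isOpen_interior
    (hI.isCompact _ (hinv _).1).isClosed.isOpen_compl
    (fun z _ => (em (z ∈ W (k + 1))).imp (fun h => hint h) id)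
    ⟨y, hUV hy, hint ((hinv _).2.1 hy)⟩ ⟨x, hxV, hxW⟩
  apply hz2
  rw [hfix]
  exact ⟨interior_subset hz1, hzV⟩

end IsIndexingCollection

end IndexingGeometry

/-! ### Metric properties of indexing collections -/

section IndexingMetric

variable {T : Type*} [TopologicalSpace T] {𝒜 : Set (Set T)} {𝒜n : ℕ → Set (Set T)}

namespace IsIndexingCollection

lemma one_le_ncard (hI : IsIndexingCollection 𝒜 𝒜n) (n : ℕ) : 1 ≤ (𝒜n n).ncard :=
  (Set.ncard_pos (hI.sub_finite n)).2 ⟨∅, hI.sub_empty_mem n⟩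

/-- Since `k_n ≤ k_{n+1}`, one has `1 / k_n ≤ k_{n+1} / k_n ^ 2`, the general term of the
admissibility series for `δ = 1`. -/
lemma tendsto_ncard (hI : IsIndexingCollection 𝒜 𝒜n) (hadm : IsAdmissible 𝒜n) :
    Tendsto (fun n => ((𝒜n n).ncard : ℝ)⁻¹) atTop (𝓝 0) := by
  refine squeeze_zero (fun n => by positivity) (fun n => ?_) (hadm 1 one_pos).tendsto_atTop_zero
  have h1 : (1 : ℝ) ≤ (𝒜n n).ncard := by exact_mod_cast hI.one_le_ncard n
  have h2 : ((𝒜n n).ncard : ℝ) ≤ (𝒜n (n + 1)).ncard := by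
    exact_mod_cast Set.ncard_le_ncard (hI.sub_mono (Nat.le_succ n)) (hI.sub_finite _)
  rw [show (1 : ℝ) + 1 = (2 : ℕ) by norm_num, Real.rpow_natCast, le_div_iff₀ (by positivity)]
  field_simp
  exact h2

lemma tendsto_rpow_ncard (hI : IsIndexingCollection 𝒜 𝒜n) (hadm : IsAdmissible 𝒜n) {q : ℝ}
    (hq : 0 < q) (M : ℝ) :
    Tendsto (fun n => M * ((𝒜n n).ncard : ℝ) ^ (-1 / q)) atTop (𝓝 0) := by
  have h1 := ((hI.tendsto_ncard hadm).rpow_const (p := 1 / q) (Or.inr (by positivity))).const_mul M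
  rw [Real.zero_rpow (by positivity), mul_zero] at h1
  refine h1.congr fun n => ?_
  rw [Real.inv_rpow (by positivity), ← Real.rpow_neg (by positivity), neg_div]

variable [MeasurableSpace T] {m : Measure T}

lemma exists_outerApprox_le (hI : IsIndexingCollection 𝒜 𝒜n) (hadm : IsAdmissible 𝒜n)
    (hq : HasDiscretizationExponent m 𝒜 𝒜n) {ε : ℝ} (hε : 0 < ε) :
    ∃ n, ∀ U ∈ 𝒜, measDist m U (outerApprox (𝒜n n) U) ≤ ε := by
  obtain ⟨q, M, hq, hM, h⟩ := hq
  obtain ⟨n, hn⟩ := ((hI.tendsto_rpow_ncard hadm hq M).eventually (gt_mem_nhds hε)).exists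
  exact ⟨n, fun U hU => (h n U hU).trans hn.le⟩

/-- The net at scale `ε` is the first `𝒜n n` with discretization error at most `ε`. Minimality
bounds the preceding cardinal by a power of `1/ε`, and admissibility with `δ = 1` allows the next
one to be at most a constant times its square. -/
lemma polyCovering_univ (hI : IsIndexingCollection 𝒜 𝒜n) (hadm : IsAdmissible 𝒜n)
    (hq : HasDiscretizationExponent m 𝒜 𝒜n) :
    PolyCovering (measDistOn m 𝒜) (Set.univ : Set 𝒜) := by
  classical
  obtain ⟨q, M, hq, hM, h⟩ := hq
  obtain ⟨Q, hQ⟩ := exists_nat_ge q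
  set k : ℕ → ℝ := fun n => ((𝒜n n).ncard : ℝ) with hk
  have hk1 : ∀ n, 1 ≤ k n := fun n => Nat.one_le_cast.2 (hI.one_le_ncard n)
  have hsum := hadm 1 one_pos
  set C₁ : ℝ := ∑' n : ℕ, k (n + 1) / k n ^ (1 + 1 : ℝ) with hC₁
  have hterm : ∀ n, 0 ≤ k (n + 1) / k n ^ (1 + 1 : ℝ) := fun n =>
    div_nonneg (zero_le_one.trans (hk1 _)) (Real.rpow_nonneg (zero_le_one.trans (hk1 _)) _)
  have hC₁0 : 0 ≤ C₁ := tsum_nonneg hterm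
  have hstep : ∀ n, k (n + 1) ≤ C₁ * k n ^ 2 := fun n => by
    have h1 : k (n + 1) / k n ^ (1 + 1 : ℝ) ≤ C₁ := hsum.le_tsum n fun j _ => hterm j
    have h2 := hk1 n
    rw [show (1 : ℝ) + 1 = (2 : ℕ) by norm_num, Real.rpow_natCast,
      div_le_iff₀ (by positivity)] at h1
    exact h1
  -- This keeps `M' ε⁻¹ ≥ 1`, so the real exponent `q` may be raised to the integer `Q`.
  set M' : ℝ := max M 1 with hM'
  have hM'1 : 1 ≤ M' := le_max_right _ _
  refine ⟨k 0 + C₁ * M' ^ (Q * 2), Q * 2, by have := hk1 0; positivity, fun ε hε hε1 => ?_⟩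
  have hinv : 1 ≤ ε⁻¹ := (one_le_inv₀ hε).2 hε1
  have hex : ∃ n, M * k n ^ (-1 / q) ≤ ε :=
    (((hI.tendsto_rpow_ncard hadm hq M).eventually (gt_mem_nhds hε)).exists).imp fun n hn => hn.le
  have hcard : k (Nat.find hex) ≤ (k 0 + C₁ * M' ^ (Q * 2)) * ε⁻¹ ^ (Q * 2) := by
    have hp : 1 ≤ ε⁻¹ ^ (Q * 2) := one_le_pow₀ hinv
    rw [add_mul]
    have hn1 : 0 ≤ C₁ * M' ^ (Q * 2) * ε⁻¹ ^ (Q * 2) := by positivity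
    have hn2 : 0 ≤ k 0 * ε⁻¹ ^ (Q * 2) := by have := hk1 0; positivity
    rcases hcase : Nat.find hex with _ | n
    · have := hk1 0
      nlinarith
    · have hlt : ε < M * k n ^ (-1 / q) := by
        have := Nat.find_min hex (m := n) (by omega)
        exact not_le.1 this
      have hkn : 0 < k n := zero_lt_one.trans_le (hk1 n)
      have h1 : k n ≤ (M' * ε⁻¹) ^ Q := by
        have h2 : k n ^ (1 / q) ≤ M' * ε⁻¹ := by
          have h3 : k n ^ (-1 / q) = (k n ^ (1 / q))⁻¹ := by
            rw [neg_div, Real.rpow_neg hkn.le]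
          have hpos : 0 < k n ^ (1 / q) := Real.rpow_pos_of_pos hkn _
          rw [h3, ← div_eq_mul_inv, lt_div_iff₀ hpos] at hlt
          rw [← div_eq_mul_inv, le_div_iff₀ hε]
          have := le_max_left M 1
          linarith
        have h4 : k n = (k n ^ (1 / q)) ^ q := by
          rw [← Real.rpow_mul hkn.le, one_div_mul_cancel hq.ne', Real.rpow_one]
        have hge1 : 1 ≤ M' * ε⁻¹ := one_le_mul_of_one_le_of_one_le hM'1 hinv
        rw [h4, ← Real.rpow_natCast]
        exact (Real.rpow_le_rpow (by positivity) h2 hq.le).trans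
          (Real.rpow_le_rpow_of_exponent_le hge1 hQ)
      have h5 : k (n + 1) ≤ C₁ * ((M' * ε⁻¹) ^ Q) ^ 2 :=
        (hstep n).trans (mul_le_mul_of_nonneg_left (pow_le_pow_left₀ hkn.le h1 2) hC₁0)
      rw [← pow_mul, mul_pow, ← mul_assoc] at h5
      linarith
  set n := Nat.find hex with hn
  refine ⟨(hI.sub_finite n).toFinset.subtype (· ∈ 𝒜), ?_, fun U _ => ?_⟩
  · refine le_trans ?_ hcard
    have h1 : ((hI.sub_finite n).toFinset.subtype (· ∈ 𝒜)).card ≤ (𝒜n n).ncard := by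
      rw [Finset.card_subtype, Set.ncard_eq_toFinset_card _ (hI.sub_finite n)]
      exact Finset.card_filter_le _ _
    exact Nat.cast_le.2 h1
  · have hmem := hI.outerApprox_mem n U U.2
    refine ⟨⟨_, hI.sub_subset n hmem⟩, ?_, (h n U U.2).trans (Nat.find_spec hex)⟩
    simpa using hmem

/-- Between `U` and `V` there are members of the collection that are close to `U`, and others
that are close to `V`. -/
lemma exists_measureReal_diff_mem_Ioc [T2Space T] [IsFiniteMeasure m] (hI : IsIndexingCollection 𝒜 𝒜n)
    (hadm : IsAdmissible 𝒜n) (hq : HasDiscretizationExponent m 𝒜 𝒜n) {U V : Set T}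
    (hU : U ∈ 𝒜) (hV : V ∈ 𝒜) (hUV : U ⊆ V) (hne : U.Nonempty) (hpos : 0 < m.real (V \ U))
    {ε : ℝ} (hε : 0 < ε) :
    (∃ W ∈ 𝒜, U ⊆ W ∧ W ⊆ V ∧ 0 < m.real (W \ U) ∧ m.real (W \ U) ≤ ε) ∧
      ∃ W ∈ 𝒜, U ⊆ W ∧ W ⊆ V ∧ 0 < m.real (V \ W) ∧ m.real (V \ W) ≤ ε := by
  classical
  obtain ⟨n, hn⟩ := hI.exists_outerApprox_le hadm hq hε
  obtain ⟨W, K, hW0, hWK, hW, hsucc⟩ := hI.exists_iterate_eq n hU hV hUV hne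
  have hinc : ∀ k, m.real (W (k + 1) \ W k) ≤ ε := fun k => by
    have h1 := hn _ (hW k).1
    rw [measDist_of_subset (subset_outerApprox _ _)] at h1
    refine (measureReal_mono ?_).trans h1
    rw [hsucc]
    exact Set.sdiff_subset_sdiff_left Set.inter_subset_left
  constructor
  · have hex : ∃ k, 0 < m.real (W k \ U) := ⟨K, by rwa [hWK]⟩
    refine ⟨W (Nat.find hex), (hW _).1, (hW _).2.1, (hW _).2.2, Nat.find_spec hex, ?_⟩
    rcases hcase : Nat.find hex with _ | k
    · rw [hW0, Set.sdiff_self, measureReal_empty]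
      exact hε.le
    · have h1 := not_lt.1 (Nat.find_min hex (m := k) (by omega))
      have h2 : m.real (W (k + 1) \ U) ≤ m.real (W k \ U) + m.real (W (k + 1) \ W k) := by
        refine (measureReal_mono ?_).trans (measureReal_union_le _ _)
        rintro x ⟨hx1, hx2⟩
        by_cases hx : x ∈ W k
        exacts [Or.inl ⟨hx, hx2⟩, Or.inr ⟨hx1, hx⟩]
      have := hinc k
      linarith
  -- Symmetrically, the set just before `V` is exhausted in measure misses at most `ε`.
  · have hex : ∃ k, m.real (V \ W k) ≤ 0 := ⟨K, by simp [hWK]⟩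
    rcases hcase : Nat.find hex with _ | k
    · have h1 := Nat.find_spec hex
      rw [hcase, hW0] at h1
      exact absurd h1 (not_le.2 hpos)
    · have h0 := Nat.find_spec hex
      rw [hcase] at h0
      refine ⟨W k, (hW _).1, (hW _).2.1, (hW _).2.2,
        not_le.1 (Nat.find_min hex (m := k) (by omega)), ?_⟩
      have h2 : m.real (V \ W k) ≤ m.real (V \ W (k + 1)) + m.real (W (k + 1) \ W k) := by
        refine (measureReal_mono ?_).trans (measureReal_union_le _ _)
        rintro x ⟨hx1, hx2⟩
        by_cases hx : x ∈ W (k + 1)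
        exacts [Or.inr ⟨hx, hx2⟩, Or.inl ⟨hx1, hx⟩]
      have := hinc k
      linarith

/-- No member of the collection is isolated, except possibly the empty set. -/
lemma exists_measDistOn_mem_Ioo [T2Space T] [IsFiniteMeasure m]
    (hI : IsIndexingCollection 𝒜 𝒜n) (hadm : IsAdmissible 𝒜n) (hq : HasDiscretizationExponent m 𝒜 𝒜n)
    (hm : 0 < m ((⋂₀ {U | U ∈ 𝒜 ∧ U.Nonempty})ᶜ)) (U₀ : 𝒜)
    (hU₀ : (U₀ : Set T) = ∅ → m (⋂₀ {U | U ∈ 𝒜 ∧ U.Nonempty}) = 0) (r : ℝ) (hr : 0 < r) :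
    ∃ U, 0 < measDistOn m 𝒜 U₀ U ∧ measDistOn m 𝒜 U₀ U < r := by
  set E := ⋂₀ {U | U ∈ 𝒜 ∧ U.Nonempty} with hE
  have hE𝒜 : E ∈ 𝒜 := hI.sInter_nonempty_mem
  have hEne : E.Nonempty := hI.nonempty_sInter_nonempty
  have hm' : 0 < m.real (Set.univ \ E) := by
    rw [← Set.compl_eq_univ_sdiff]
    exact ENNReal.toReal_pos hm.ne' (measure_ne_top _ _)
  have hr2 : 0 < r / 2 := half_pos hr
  -- The empty set is reached through sets slightly larger than the null set `E`. A nonempty `U₀` is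
  -- approached from inside if `U₀ \ E` has positive measure, and otherwise from outside, where all
  -- the mass of the complement of `E` then lies.
  rcases (U₀ : Set T).eq_empty_or_nonempty with h0 | hne
  · obtain ⟨W, hW, hEW, -, hW1, hW2⟩ := (hI.exists_measureReal_diff_mem_Ioc hadm hq hE𝒜
      hI.univ_mem (Set.subset_univ _) hEne hm' hr2).1
    have hEz : m.real E = 0 := by rw [measureReal_def, hU₀ h0, ENNReal.toReal_zero]
    have h1 : m.real W = m.real (W \ E) := by
      have h2 : m.real W ≤ m.real (W \ E) + m.real E := by
        refine (measureReal_mono ?_).trans (measureReal_union_le _ _)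
        rw [Set.sdiff_union_self]
        exact Set.subset_union_left
      have h3 : m.real (W \ E) ≤ m.real W := measureReal_mono Set.sdiff_subset
      linarith
    refine ⟨⟨W, hW⟩, ?_⟩
    have h2 : measDistOn m 𝒜 U₀ ⟨W, hW⟩ = m.real (W \ E) := by
      simp only [measDistOn]
      rw [h0, measDist_of_subset (Set.empty_subset _), Set.sdiff_empty, h1]
    rw [h2]
    exact ⟨hW1, by linarith⟩
  · have hEU : E ⊆ U₀ := Set.sInter_subset_of_mem ⟨U₀.2, hne⟩
    by_cases hpos : 0 < m.real ((U₀ : Set T) \ E)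
    · obtain ⟨W, hW, -, hWU, hW1, hW2⟩ := (hI.exists_measureReal_diff_mem_Ioc hadm hq hE𝒜
        U₀.2 hEU hEne hpos hr2).2
      refine ⟨⟨W, hW⟩, ?_⟩
      have h2 : measDistOn m 𝒜 U₀ ⟨W, hW⟩ = m.real (U₀ \ W) := by
        simp only [measDistOn]
        rw [measDist_comm, measDist_of_subset hWU]
      rw [h2]
      exact ⟨hW1, by linarith⟩
    · have hpos' : 0 < m.real (Set.univ \ (U₀ : Set T)) := by
        have h2 : m.real (Set.univ \ E) ≤
            m.real (Set.univ \ (U₀ : Set T)) + m.real ((U₀ : Set T) \ E) := by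
          refine (measureReal_mono ?_).trans (measureReal_union_le _ _)
          rintro x ⟨hx1, hx2⟩
          by_cases hx : x ∈ (U₀ : Set T)
          exacts [Or.inr ⟨hx, hx2⟩, Or.inl ⟨hx1, hx⟩]
        linarith
      obtain ⟨W, hW, hUW, -, hW1, hW2⟩ := (hI.exists_measureReal_diff_mem_Ioc hadm hq U₀.2
        hI.univ_mem (Set.subset_univ _) hne hpos' hr2).1
      refine ⟨⟨W, hW⟩, ?_⟩
      have h2 : measDistOn m 𝒜 U₀ ⟨W, hW⟩ = m.real (W \ U₀) := measDist_of_subset hUW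
      rw [h2]
      exact ⟨hW1, by linarith⟩

/-- The pair is `U` and `g_n(U)`; the constant drops to `η / 2` because the supremum need not be
attained. -/
lemma exists_hasLargePairs (hI : IsIndexingCollection 𝒜 𝒜n) (hL : HasLargeIncrements m 𝒜 𝒜n) :
    ∃ c : ℝ, 0 < c ∧ ∀ U₀ : 𝒜, HasLargePairs (measDistOn m 𝒜) c U₀ := by
  obtain ⟨η, hη, h⟩ := hL
  refine ⟨η / 2, by positivity, fun U₀ => ?_⟩
  obtain ⟨ρ₀, hρ₀, h⟩ := h U₀ U₀.2
  refine ⟨ρ₀, hρ₀, fun ρ hρ hρ1 => ?_⟩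
  have h1 := (le_iInf₂_iff.1 h) ρ ⟨hρ, hρ1⟩
  have h2 : ENNReal.ofReal (η / 2) < ENNReal.ofReal η :=
    (ENNReal.ofReal_lt_ofReal_iff hη).2 (by linarith)
  have h3 := h2.trans_le h1
  simp only [lt_iSup_iff] at h3
  obtain ⟨n, U, hU, hU1, hU2, hlt⟩ := h3
  refine ⟨⟨U, hU⟩, ⟨_, hI.sub_subset n (hI.outerApprox_mem n U hU)⟩, hU1, hU2, ?_⟩
  have h4 := (ENNReal.ofReal_lt_ofReal_iff_of_nonneg (by positivity)).1 hlt
  rw [lt_div_iff₀ hρ] at h4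
  exact h4.le

end IsIndexingCollection

end IndexingMetric

/-- Hölder exponents of the set-indexed fractional Brownian motion on an indexing collection. -/
theorem ae_holderExponents_eq_of_isIndexingCollection {Ω : Type*} [MeasurableSpace Ω]
    {P : Measure Ω} [IsProbabilityMeasure P] {H : ℝ} (hH0 : 0 < H) (hH : H ≤ 1 / 2)
    {T : Type*} [TopologicalSpace T] [T2Space T] [MeasurableSpace T]
    {m : Measure T} [IsFiniteMeasureOnCompacts m] {𝒜 : Set (Set T)} {𝒜n : ℕ → Set (Set T)}
    (hI : IsIndexingCollection 𝒜 𝒜n) (hadm : IsAdmissible 𝒜n)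
    (hq : HasDiscretizationExponent m 𝒜 𝒜n) (hm : 0 < m ((⋂₀ {U | U ∈ 𝒜 ∧ U.Nonempty})ᶜ))
    {X : 𝒜 → Ω → ℝ} (hX : IsSIfBm m 𝒜 H X P) (hsep : IsSeparableProcess (measDistOn m 𝒜) X P)
    {d : 𝒜 → 𝒜 → ℝ} (hd : IsPseudoDist d) (hdd : EquivalentDist d (measDistOn m 𝒜)) :
    (∀ᵐ ω ∂P, ∀ U₀ : 𝒜, ((U₀ : Set T) = ∅ → m (⋂₀ {U | U ∈ 𝒜 ∧ U.Nonempty}) = 0) →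
      localHolderExponent d (fun U => X U ω) U₀ = (H : EReal)) ∧
    (HasLargeIncrements m 𝒜 𝒜n → ∀ᵐ ω ∂P, ∀ U₀ : 𝒜,
      pointwiseHolderExponent d (fun U => X U ω) U₀ = (H : EReal)) := by
  -- The whole space belongs to `𝒜`, hence is compact.
  have : IsFiniteMeasure m := ⟨(hI.isCompact _ hI.univ_mem).measure_lt_top⟩
  have hd₀ : IsPseudoDist (measDistOn m 𝒜) := isPseudoDist_measDistOn fun U _ => measure_ne_top m U
  have hcov := hI.polyCovering_univ hadm hq
  constructor
  · filter_upwards [hX.isFractionalField.ae_localHolderExponent_eq hd₀ hsep hH0 hH hcov hd hdd]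
      with ω hω U₀ hU₀
    exact hω U₀ (hI.exists_measDistOn_mem_Ioo hadm hq hm U₀ hU₀)
  · intro hL
    obtain ⟨c, hc, hpairs⟩ := hI.exists_hasLargePairs hL
    filter_upwards [hX.isFractionalField.ae_holderExponents_eq hd₀ hsep hH0 hH (A := fun _ =>
      Set.univ) (fun _ => hcov) hd hdd hc] with ω hω U₀
    exact (hω U₀ ⟨0, 1, one_pos, Set.subset_univ _⟩ (hpairs U₀)).1

/-! ### Rectangles -/

section Rectangles

variable {N : ℕ} {𝒜 : Set (Set (Fin N → ℝ))} {s t b : Fin N → ℝ}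

lemma rectanglesIn_subset_rectangles (b : Fin N → ℝ) : rectanglesIn b ⊆ rectangles N := by
  rintro U (rfl | ⟨t, ht, -, rfl⟩)
  exacts [Or.inl rfl, Or.inr ⟨t, ht, rfl⟩]

lemma volume_ne_top_of_mem_rectangles {U : Set (Fin N → ℝ)} (hU : U ∈ rectangles N) :
    volume U ≠ ∞ := by
  rcases hU with rfl | ⟨t, -, rfl⟩
  · simp
  · exact isCompact_Icc.measure_ne_top

lemma volumeReal_Icc_zero (ht : 0 ≤ t) : volume.real (Set.Icc 0 t) = ∏ i, t i := by
  rw [measureReal_def, Real.volume_Icc_pi_toReal ht]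
  simp

lemma measDist_Icc_of_le (hs : 0 ≤ s) (hst : s ≤ t) :
    measDist volume (Set.Icc 0 s) (Set.Icc 0 t) = ∏ i, t i - ∏ i, s i := by
  rw [measDist_of_subset (Set.Icc_subset_Icc_right hst),
    measureReal_sdiff (Set.Icc_subset_Icc_right hst) measurableSet_Icc
      isCompact_Icc.measure_ne_top, volumeReal_Icc_zero hs, volumeReal_Icc_zero (hs.trans hst)]

lemma measureReal_le_add_measDist {T : Type*} [MeasurableSpace T] {m : Measure T} {U V : Set T}
    (hU : m U ≠ ∞) (hV : m V ≠ ∞) : m.real V ≤ m.real (U ∩ V) + measDist m U V := by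
  have h1 : m (U ∆ V) ≠ ∞ := ne_top_of_le_ne_top (ENNReal.add_ne_top.2 ⟨hU, hV⟩)
    ((measure_mono Set.symmDiff_subset_union).trans (measure_union_le _ _))
  refine (measureReal_mono ?_ ?_).trans (measureReal_union_le _ _)
  · intro x hx
    by_cases h : x ∈ U
    · exact Or.inl ⟨h, hx⟩
    · exact Or.inr (Or.inr ⟨hx, h⟩)
  · exact ne_top_of_le_ne_top (ENNReal.add_ne_top.2
      ⟨ne_top_of_le_ne_top hU (measure_mono Set.inter_subset_left), h1⟩) (measure_union_le _ _)

lemma measDist_le_add {T : Type*} [MeasurableSpace T] {m : Measure T} {U V : Set T}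
    (hU : m U ≠ ∞) (hV : m V ≠ ∞) : measDist m U V ≤ m.real U + m.real V :=
  (measureReal_mono Set.symmDiff_subset_union
    (ne_top_of_le_ne_top (ENNReal.add_ne_top.2 ⟨hU, hV⟩) (measure_union_le _ _))).trans
    (measureReal_union_le _ _)

/-- Coordinates are changed one at a time; with all factors in `[0, 1]`, each change costs at most
its own size. -/
lemma prod_le_prod_add_sum_sub {κ : Type*} (S : Finset κ) {x y : κ → ℝ} (hy : ∀ i ∈ S, 0 ≤ y i)
    (hyx : ∀ i ∈ S, y i ≤ x i) (hx : ∀ i ∈ S, x i ≤ 1) :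
    ∏ i ∈ S, x i ≤ ∏ i ∈ S, y i + ∑ i ∈ S, (x i - y i) := by
  classical
  induction S using Finset.induction_on with
  | empty => simp
  | insert a S ha ih =>
    rw [Finset.prod_insert ha, Finset.prod_insert ha, Finset.sum_insert ha]
    have h1 := ih (fun i hi => hy i (Finset.mem_insert_of_mem hi))
      (fun i hi => hyx i (Finset.mem_insert_of_mem hi))
      (fun i hi => hx i (Finset.mem_insert_of_mem hi))
    have hya := hy a (Finset.mem_insert_self _ _)
    have hyxa := hyx a (Finset.mem_insert_self _ _)
    have hxa := hx a (Finset.mem_insert_self _ _)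
    have hp1 : ∏ i ∈ S, y i ≤ 1 := Finset.prod_le_one
      (fun i hi => hy i (Finset.mem_insert_of_mem hi))
      (fun i hi => (hyx i (Finset.mem_insert_of_mem hi)).trans
        (hx i (Finset.mem_insert_of_mem hi)))
    have hs0 : 0 ≤ ∑ i ∈ S, (x i - y i) := Finset.sum_nonneg fun i hi =>
      sub_nonneg.2 (hyx i (Finset.mem_insert_of_mem hi))
    have h2 := mul_le_mul_of_nonneg_left h1 (hya.trans hyxa)
    have h3 := mul_le_mul_of_nonneg_right hxa hs0
    have h4 := mul_le_mul_of_nonneg_left hp1 (sub_nonneg.2 hyxa)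
    nlinarith

/-- Boxes inside a bounded box are polynomially covered by a regular grid. -/
lemma polyCovering_rectangles (hN : 1 ≤ N) (hb : ∀ i, 0 < b i)
    (h𝒜 : ∀ s, 0 ≤ s → s ≤ b → Set.Icc 0 s ∈ 𝒜) :
    PolyCovering (measDistOn volume 𝒜) {U : 𝒜 | (U : Set (Fin N → ℝ)) ∈ rectanglesIn b} := by
  classical
  set V : ℝ := ∏ i, b i with hV
  have hV0 : 0 < V := Finset.prod_pos fun i _ => hb i
  refine ⟨(N * V + 3) ^ N, N, by positivity, fun ε hε hε1 => ?_⟩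
  -- Rounding each of the `N` relative coordinates down by at most `1 / n` loses volume at most `N V
  -- / n`.
  set n : ℕ := ⌈N * V / ε⌉₊ + 1 with hn
  have hn0 : (0 : ℝ) < n := by positivity
  have hnε : N * V / n ≤ ε := by
    rw [div_le_iff₀ hn0, mul_comm ε, ← div_le_iff₀ hε, hn]
    push_cast
    have := Nat.le_ceil (N * V / ε)
    linarith
  set grid : (Fin N → Fin (n + 1)) → Fin N → ℝ := fun k i => b i * ((k i : ℕ) / (n : ℝ)) with hgrid
  have hfrac0 : ∀ (k : Fin N → Fin (n + 1)) i, 0 ≤ ((k i : ℕ) : ℝ) / n := fun k i => by positivity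
  have hgrid0 : ∀ k, 0 ≤ grid k := fun k i => mul_nonneg (hb i).le (hfrac0 k i)
  have hgridb : ∀ k, grid k ≤ b := fun k i => by
    refine mul_le_of_le_one_right (hb i).le ?_
    rw [div_le_one hn0]
    exact_mod_cast Nat.lt_succ_iff.1 (k i).2
  refine ⟨Finset.univ.image fun k => (⟨Set.Icc 0 (grid k), h𝒜 _ (hgrid0 k) (hgridb k)⟩ : 𝒜),
    ?_, fun U hU => ?_⟩
  · have h1 : ((Finset.univ.image fun k =>
        (⟨Set.Icc 0 (grid k), h𝒜 _ (hgrid0 k) (hgridb k)⟩ : 𝒜)).card : ℝ) ≤ (n + 1 : ℝ) ^ N := by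
      have h2 := Finset.card_image_le (s := Finset.univ)
        (f := fun k => (⟨Set.Icc 0 (grid k), h𝒜 _ (hgrid0 k) (hgridb k)⟩ : 𝒜))
      rw [Finset.card_univ, Fintype.card_fun, Fintype.card_fin, Fintype.card_fin] at h2
      exact_mod_cast h2
    refine h1.trans ?_
    rw [← mul_pow]
    refine pow_le_pow_left₀ (by positivity) ?_ N
    have h3 : (n : ℝ) ≤ N * V / ε + 2 := by
      rw [hn]
      push_cast
      have := (Nat.ceil_lt_add_one (show 0 ≤ N * V / ε by positivity)).le
      linarith
    have h4 : 1 ≤ ε⁻¹ := (one_le_inv₀ hε).2 hε1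
    rw [add_mul, ← div_eq_mul_inv]
    linarith
  · rcases hU with h0 | ⟨t, ht, htb, hUt⟩
    -- The degenerate box at the origin is null since `N ≥ 1`, so it represents the empty set.
    · refine ⟨⟨Set.Icc 0 (grid fun _ => 0), h𝒜 _ (hgrid0 _) (hgridb _)⟩,
        Finset.mem_image_of_mem _ (Finset.mem_univ _), ?_⟩
      simp only [measDistOn]
      rw [h0, measDist_of_subset (Set.empty_subset _), Set.sdiff_empty,
        volumeReal_Icc_zero (hgrid0 _)]
      simp only [hgrid]
      rw [Finset.prod_eq_zero (Finset.mem_univ (⟨0, hN⟩ : Fin N)) (by simp)]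
      exact hε.le
    · have hx1 : ∀ i, t i / b i ≤ 1 := fun i => (div_le_one (hb i)).2 (htb i)
      have hx0 : ∀ i, 0 ≤ t i / b i := fun i => div_nonneg (ht i) (hb i).le
      have hfl : ∀ i, ⌊n * (t i / b i)⌋₊ < n + 1 := fun i => by
        rw [Nat.lt_succ_iff]
        refine Nat.floor_le_of_le ?_
        exact mul_le_of_le_one_right hn0.le (hx1 i)
      set k : Fin N → Fin (n + 1) := fun i => ⟨⌊n * (t i / b i)⌋₊, hfl i⟩ with hk
      have hy : ∀ i, ((k i : ℕ) : ℝ) / n ≤ t i / b i := fun i => by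
        rw [div_le_iff₀ hn0, mul_comm]
        exact Nat.floor_le (mul_nonneg hn0.le (hx0 i))
      have hxy : ∀ i, t i / b i - ((k i : ℕ) : ℝ) / n ≤ 1 / n := fun i => by
        have h1 := (Nat.lt_floor_add_one (n * (t i / b i))).le
        have h2 : t i / b i ≤ (((k i : ℕ) : ℝ) + 1) / n := by
          rw [le_div_iff₀ hn0, mul_comm]
          exact h1
        rw [add_div] at h2
        linarith
      have hgt : grid k ≤ t := fun i => by
        have h1 := mul_le_mul_of_nonneg_left (hy i) (hb i).le
        rwa [mul_div_cancel₀ _ (hb i).ne'] at h1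
      refine ⟨⟨Set.Icc 0 (grid k), h𝒜 _ (hgrid0 _) (hgridb _)⟩,
        Finset.mem_image_of_mem _ (Finset.mem_univ _), ?_⟩
      simp only [measDistOn]
      rw [hUt, measDist_comm, measDist_Icc_of_le (hgrid0 k) hgt]
      have e1 : ∏ i, t i = V * ∏ i, (t i / b i) := by
        rw [hV, ← Finset.prod_mul_distrib]
        exact Finset.prod_congr rfl fun i _ => (mul_div_cancel₀ _ (hb i).ne').symm
      have e2 : ∏ i, grid k i = V * ∏ i, (((k i : ℕ) : ℝ) / n) := by
        rw [hV, ← Finset.prod_mul_distrib]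
      have h1 := prod_le_prod_add_sum_sub Finset.univ (fun i _ => hfrac0 k i) (fun i _ => hy i)
        (fun i _ => hx1 i)
      have h2 : ∑ i, (t i / b i - ((k i : ℕ) : ℝ) / n) ≤ N * (1 / n) := by
        refine (Finset.sum_le_sum fun i _ => hxy i).trans (le_of_eq ?_)
        simp
      rw [e1, e2, ← mul_sub]
      calc V * _ ≤ V * (N * (1 / n)) := mul_le_mul_of_nonneg_left (by linarith) hV0.le
        _ = N * V / n := by ring
        _ ≤ ε := hnε

/-- A box contains boxes with the same vertex of any smaller volume. -/
lemma exists_prod_eq (hN : 1 ≤ N) (ht : 0 ≤ t) {δ : ℝ} (hδ : 0 ≤ δ) (hδt : δ ≤ ∏ i, t i)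
    (hpos : 0 < ∏ i, t i) : ∃ s : Fin N → ℝ, 0 ≤ s ∧ s ≤ t ∧ ∏ i, s i = δ := by
  set x : ℝ := δ / ∏ i, t i with hx
  have hx0 : 0 ≤ x := div_nonneg hδ hpos.le
  have hx1 : x ≤ 1 := (div_le_one hpos).2 hδt
  set y : ℝ := x ^ ((N : ℝ)⁻¹) with hy
  have hy0 : 0 ≤ y := Real.rpow_nonneg hx0 _
  have hy1 : y ≤ 1 := Real.rpow_le_one hx0 hx1 (by positivity)
  -- Homothety of ratio `(δ / ∏ t i) ^ (1 / N)`.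
  refine ⟨fun i => y * t i, fun i => mul_nonneg hy0 (ht i),
    fun i => mul_le_of_le_one_left (ht i) hy1, ?_⟩
  rw [Finset.prod_mul_distrib, Finset.prod_const, Finset.card_univ, Fintype.card_fin, hy,
    Real.rpow_inv_natCast_pow hx0 (by omega), hx, div_mul_cancel₀ _ hpos.ne']

/-- `U₀` is paired with a box at distance exactly `ρ / 2`: a shrunken copy of `U₀` if its volume is
positive, and otherwise a box of volume `ρ / 2` inside `[0, b]`. -/
lemma hasLargePairs_rectangles (hN : 1 ≤ N) (h𝒜 : 𝒜 ⊆ rectangles N)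
    (hdown : ∀ s t, 0 ≤ s → s ≤ t → Set.Icc 0 t ∈ 𝒜 → Set.Icc 0 s ∈ 𝒜) (hb : ∀ i, 0 < b i)
    (hb𝒜 : Set.Icc 0 b ∈ 𝒜) (U₀ : 𝒜) : HasLargePairs (measDistOn volume 𝒜) (1 / 2) U₀ := by
  have hself : measDistOn volume 𝒜 U₀ U₀ = 0 := by simp [measDistOn, measDist]
  have hb0 : 0 ≤ b := fun i => (hb i).le
  have hV0 : 0 < ∏ i, b i := Finset.prod_pos fun i _ => hb i
  have hfin : ∀ U ∈ 𝒜, volume U ≠ ∞ := fun U hU => volume_ne_top_of_mem_rectangles (h𝒜 hU)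
  rcases (measureReal_nonneg (μ := volume) (s := (U₀ : Set (Fin N → ℝ)))).eq_or_lt with h0 | hpos
  · refine ⟨∏ i, b i, hV0, fun ρ hρ hρb => ?_⟩
    obtain ⟨s, hs0, hsb, hs⟩ := exists_prod_eq hN hb0 (half_pos hρ).le (by linarith) hV0
    have hs𝒜 := hdown s b hs0 hsb hb𝒜
    have hvol : volume.real (Set.Icc 0 s) = ρ / 2 := by rw [volumeReal_Icc_zero hs0, hs]
    have hup : measDistOn volume 𝒜 U₀ ⟨_, hs𝒜⟩ ≤ ρ / 2 := by
      have := measDist_le_add (hfin U₀ U₀.2) (hfin _ hs𝒜)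
      rwa [← h0, hvol, zero_add] at this
    have hlo : ρ / 2 ≤ measDistOn volume 𝒜 U₀ ⟨_, hs𝒜⟩ := by
      have h1 := measureReal_le_add_measDist (hfin U₀ U₀.2) (hfin _ hs𝒜)
      have h2 : volume.real ((U₀ : Set (Fin N → ℝ)) ∩ Set.Icc 0 s) ≤ 0 := by
        rw [h0]
        exact measureReal_mono Set.inter_subset_left (hfin U₀ U₀.2)
      rw [hvol] at h1
      exact h1.trans (by simp only [measDistOn]; linarith)
    exact ⟨U₀, ⟨_, hs𝒜⟩, by rwa [hself], by linarith, by linarith⟩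
  · refine ⟨_, hpos, fun ρ hρ hρb => ?_⟩
    obtain ⟨U, hU⟩ := U₀
    simp only at hpos hρb
    rcases h𝒜 hU with rfl | ⟨t, ht, rfl⟩
    · simp at hpos
    · rw [volumeReal_Icc_zero ht] at hpos hρb
      obtain ⟨s, hs0, hst, hs⟩ := exists_prod_eq hN ht (δ := ∏ i, t i - ρ / 2) (by linarith)
        (by linarith) hpos
      have hs𝒜 := hdown s t hs0 hst hU
      have hdist : measDistOn volume 𝒜 ⟨_, hU⟩ ⟨_, hs𝒜⟩ = ρ / 2 := by
        simp only [measDistOn]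
        rw [measDist_comm, measDist_Icc_of_le hs0 hst, hs]
        ring
      exact ⟨⟨_, hU⟩, ⟨_, hs𝒜⟩, by rwa [hself], by rw [hdist]; linarith, by rw [hdist]; linarith⟩

/-- Around a rectangle of positive volume, small balls for `d_λ` consist of rectangles contained
in a fixed bounded box; in dimension one this holds around every rectangle. -/
lemma exists_openBall_subset_rectanglesIn (U₀ : rectangles N)
    (hU₀ : N = 1 ∨ 0 < volume (U₀ : Set (Fin N → ℝ))) :
    ∃ k : ℕ, ∃ r : ℝ, 0 < r ∧ openBall (measDistOn volume (rectangles N)) U₀ r ⊆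
      {U | (U : Set (Fin N → ℝ)) ∈ rectanglesIn fun _ => (k : ℝ) + 1} := by
  have hfin : ∀ U ∈ rectangles N, volume U ≠ ∞ := fun U hU => volume_ne_top_of_mem_rectangles hU
  rcases (measureReal_nonneg (μ := volume) (s := (U₀ : Set (Fin N → ℝ)))).eq_or_lt with h0 | hpos
  · have hN1 : N = 1 := by
      refine hU₀.resolve_right fun h => ?_
      rw [measureReal_def] at h0
      exact (ENNReal.toReal_pos h.ne' (hfin U₀ U₀.2)).ne h0
    subst hN1
    refine ⟨0, 1, one_pos, ?_⟩
    rintro ⟨U, hU⟩ hball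
    rcases hU with rfl | ⟨s, hs, rfl⟩
    · exact Or.inl rfl
    · refine Or.inr ⟨s, hs, fun i => ?_, rfl⟩
      have hball : measDist volume (U₀ : Set (Fin 1 → ℝ)) (Set.Icc 0 s) < 1 := hball
      have h1 := measureReal_le_add_measDist (hfin U₀ U₀.2) (hfin _ (Or.inr ⟨s, hs, rfl⟩))
      have h2 : volume.real ((U₀ : Set (Fin 1 → ℝ)) ∩ Set.Icc 0 s) ≤ 0 := by
        rw [h0]
        exact measureReal_mono Set.inter_subset_left (hfin U₀ U₀.2)
      rw [volumeReal_Icc_zero hs, Fin.prod_univ_one] at h1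
      rw [Subsingleton.elim i 0]
      simp only [Nat.cast_zero]
      linarith
  · obtain ⟨U, hU⟩ := U₀
    simp only at hpos
    rcases hU with rfl | ⟨t, ht, rfl⟩
    · simp at hpos
    · have hvt := volumeReal_Icc_zero ht
      set v : ℝ := volume.real (Set.Icc 0 t) with hv
      -- Within distance `v / 2` the box `[0, s]` has volume at most `3v / 2` and meets `[0, t]` in
      -- volume at least `v / 2`; the quotient of these bounds is the `3` in `s i ≤ 3 t i`.
      obtain ⟨k, hk⟩ := exists_nat_ge (3 * ∑ i, t i)
      refine ⟨k, v / 2, half_pos hpos, ?_⟩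
      rintro ⟨U, hU⟩ hball
      rcases hU with rfl | ⟨s, hs, rfl⟩
      · exact Or.inl rfl
      · refine Or.inr ⟨s, hs, fun i => ?_, rfl⟩
        have hball : measDist volume (Set.Icc 0 t) (Set.Icc 0 s) < v / 2 := hball
        have hs𝒜 : Set.Icc 0 s ∈ rectangles N := Or.inr ⟨s, hs, rfl⟩
        have ht𝒜 : Set.Icc 0 t ∈ rectangles N := Or.inr ⟨t, ht, rfl⟩
        have h1 := measureReal_le_add_measDist (hfin _ ht𝒜) (hfin _ hs𝒜)
        have h2 := measureReal_le_add_measDist (hfin _ hs𝒜) (hfin _ ht𝒜)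
        rw [measDist_comm, Set.inter_comm] at h2
        set w : ℝ := volume.real (Set.Icc 0 t ∩ Set.Icc 0 s) with hw
        have hwv : w ≤ v := measureReal_mono Set.inter_subset_left (hfin _ ht𝒜)
        have hw2 : w = ∏ i, min (t i) (s i) := by
          rw [hw, Set.Icc_inter_Icc, sup_idem,
            volumeReal_Icc_zero (le_inf ht hs)]
          rfl
        rw [volumeReal_Icc_zero hs] at h1
        -- The intersection occupies at most the fraction `t i / s i` of `[0, s]`; this prevents
        -- thin, very long boxes from being close to `[0, t]`.
        have h3 : s i * w ≤ t i * ∏ j, s j := by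
          rw [hw2, ← Finset.mul_prod_erase _ _ (Finset.mem_univ i),
            ← Finset.mul_prod_erase Finset.univ s (Finset.mem_univ i), ← mul_assoc, ← mul_assoc,
            mul_comm (t i)]
          refine mul_le_mul (mul_le_mul_of_nonneg_left (min_le_left _ _) (hs i))
            (Finset.prod_le_prod (fun j _ => le_min (ht j) (hs j)) fun j _ => min_le_right _ _)
            (Finset.prod_nonneg fun j _ => le_min (ht j) (hs j)) (mul_nonneg (hs i) (ht i))
        have h4 : s i ≤ 3 * t i := by
          have hti : 0 ≤ t i := ht i
          have hsi : 0 ≤ s i := hs i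
          have h5 : s i * (v / 2) ≤ s i * w := mul_le_mul_of_nonneg_left (by linarith) hsi
          have h6 : t i * ∏ j, s j ≤ t i * (3 * (v / 2)) :=
            mul_le_mul_of_nonneg_left (by linarith) hti
          have h7 : s i * (v / 2) ≤ 3 * t i * (v / 2) := by linarith
          exact le_of_mul_le_mul_right h7 (half_pos hpos)
        have h8 : t i ≤ ∑ j, t j := Finset.single_le_sum (fun j _ => ht j) (Finset.mem_univ i)
        linarith

end Rectangles

end SetIndexed

theorem mainTheorem4 {Ω : Type*} [MeasurableSpace Ω] (P : Measure Ω) [IsProbabilityMeasure P]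
    (H : ℝ) (hH0 : 0 < H) (hH : H ≤ 1 / 2) :
    -- general indexing collections
    (∀ (T : Type*) [MetricSpace T] [CompleteSpace T] [LocallyCompactSpace T]
        [SecondCountableTopology T] [MeasurableSpace T] [BorelSpace T]
        (m : Measure T) [m.Regular] (𝒜 : Set (Set T)) (𝒜n : ℕ → Set (Set T)),
      SetIndexed.IsIndexingCollection 𝒜 𝒜n →
      SetIndexed.IsAdmissible 𝒜n →
      SetIndexed.HasDiscretizationExponent m 𝒜 𝒜n →
      0 < m ((⋂₀ {U | U ∈ 𝒜 ∧ U.Nonempty})ᶜ) →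
      ∀ X : 𝒜 → Ω → ℝ,
        SetIndexed.IsSIfBm m 𝒜 H X P →
        SetIndexed.IsSeparableProcess (SetIndexed.measDistOn m 𝒜) X P →
        ∀ d : 𝒜 → 𝒜 → ℝ, SetIndexed.IsPseudoDist d →
          SetIndexed.EquivalentDist d (SetIndexed.measDistOn m 𝒜) →
          (∀ᵐ ω ∂P, ∀ U₀ : 𝒜,
            ((U₀ : Set T) = ∅ → m (⋂₀ {U | U ∈ 𝒜 ∧ U.Nonempty}) = 0) →
            SetIndexed.localHolderExponent d (fun U => X U ω) U₀ = (H : EReal)) ∧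
          (SetIndexed.HasLargeIncrements m 𝒜 𝒜n →
            ∀ᵐ ω ∂P, ∀ U₀ : 𝒜,
              SetIndexed.pointwiseHolderExponent d (fun U => X U ω) U₀ = (H : EReal))) ∧
    -- multiparameter fractional Brownian motion on all rectangles of `ℝ₊ᴺ`
    (∀ N : ℕ, 1 ≤ N → ∀ X : SetIndexed.rectangles N → Ω → ℝ,
      SetIndexed.IsSIfBm volume (SetIndexed.rectangles N) H X P →
      SetIndexed.IsSeparableProcess
        (SetIndexed.measDistOn volume (SetIndexed.rectangles N)) X P →
      ∀ d : SetIndexed.rectangles N → SetIndexed.rectangles N → ℝ, SetIndexed.IsPseudoDist d →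
        SetIndexed.EquivalentDist d (SetIndexed.measDistOn volume (SetIndexed.rectangles N)) →
        ∀ᵐ ω ∂P, ∀ U₀ : SetIndexed.rectangles N,
          (N = 1 ∨ 0 < volume (U₀ : Set (Fin N → ℝ))) →
          SetIndexed.pointwiseHolderExponent d (fun U => X U ω) U₀ = (H : EReal) ∧
          SetIndexed.localHolderExponent d (fun U => X U ω) U₀ = (H : EReal)) ∧
    -- multiparameter fractional Brownian motion on the rectangles of a compact box `[0, b]`
    (∀ N : ℕ, 1 ≤ N → ∀ b : Fin N → ℝ, (∀ i, 0 < b i) →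
      ∀ X : SetIndexed.rectanglesIn b → Ω → ℝ,
      SetIndexed.IsSIfBm volume (SetIndexed.rectanglesIn b) H X P →
      SetIndexed.IsSeparableProcess
        (SetIndexed.measDistOn volume (SetIndexed.rectanglesIn b)) X P →
      ∀ d : SetIndexed.rectanglesIn b → SetIndexed.rectanglesIn b → ℝ,
        SetIndexed.IsPseudoDist d →
        SetIndexed.EquivalentDist d (SetIndexed.measDistOn volume (SetIndexed.rectanglesIn b)) →
        ∀ᵐ ω ∂P, ∀ U₀ : SetIndexed.rectanglesIn b,
          SetIndexed.pointwiseHolderExponent d (fun U => X U ω) U₀ = (H : EReal) ∧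
          SetIndexed.localHolderExponent d (fun U => X U ω) U₀ = (H : EReal)) := by
  refine ⟨fun T _ _ _ _ _ _ m _ 𝒜 𝒜n hI hadm hq hm X hX hsep d hd hdd =>
    SetIndexed.ae_holderExponents_eq_of_isIndexingCollection hH0 hH hI hadm hq hm hX hsep hd hdd,
    fun N hN X hX hsep d hd hdd => ?_, fun N hN b hb X hX hsep d hd hdd => ?_⟩
  · have hfin : ∀ U ∈ SetIndexed.rectangles N, volume U ≠ ∞ := fun U hU =>
      SetIndexed.volume_ne_top_of_mem_rectangles hU
    have hcov : ∀ k : ℕ, SetIndexed.PolyCovering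
        (SetIndexed.measDistOn volume (SetIndexed.rectangles N))
        {U | (U : Set (Fin N → ℝ)) ∈ SetIndexed.rectanglesIn fun _ => (k : ℝ) + 1} := fun k =>
      SetIndexed.polyCovering_rectangles hN (fun _ => by positivity)
        fun s hs _ => Or.inr ⟨s, hs, rfl⟩
    filter_upwards [hX.isFractionalField.ae_holderExponents_eq
      (SetIndexed.isPseudoDist_measDistOn hfin) hsep hH0 hH hcov hd hdd one_half_pos]
      with ω hω U₀ hU₀
    -- Boxes inside the unit cube serve as partners for sets of volume zero.
    exact hω U₀ (SetIndexed.exists_openBall_subset_rectanglesIn U₀ hU₀)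
      (SetIndexed.hasLargePairs_rectangles hN subset_rfl
        (fun s _ hs _ _ => Or.inr ⟨s, hs, rfl⟩) (b := fun _ => 1) (fun _ => one_pos)
        (Or.inr ⟨_, fun _ => zero_le_one, rfl⟩) U₀)
  · have hfin : ∀ U ∈ SetIndexed.rectanglesIn b, volume U ≠ ∞ := fun U hU =>
      SetIndexed.volume_ne_top_of_mem_rectangles (SetIndexed.rectanglesIn_subset_rectangles b hU)
    have hcov := SetIndexed.polyCovering_rectangles (𝒜 := SetIndexed.rectanglesIn b) hN hb
      fun s hs hsb => Or.inr ⟨s, hs, hsb, rfl⟩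
    have hdown : ∀ s t : Fin N → ℝ, 0 ≤ s → s ≤ t → Set.Icc 0 t ∈ SetIndexed.rectanglesIn b →
        Set.Icc 0 s ∈ SetIndexed.rectanglesIn b := by
      rintro s t hs hst (h0 | ⟨t', ht', htb, heq⟩)
      · exact absurd h0 (Set.nonempty_Icc.2 (hs.trans hst)).ne_empty
      · have ht : t ∈ Set.Icc 0 t' := heq ▸ Set.right_mem_Icc.2 (hs.trans hst)
        exact Or.inr ⟨s, hs, hst.trans (ht.2.trans htb), rfl⟩
    filter_upwards [hX.isFractionalField.ae_holderExponents_eq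
      (SetIndexed.isPseudoDist_measDistOn hfin) hsep hH0 hH (fun _ : ℕ => hcov) hd hdd
      one_half_pos] with ω hω U₀
    exact hω U₀ ⟨0, 1, one_pos, fun U _ => U.2⟩
      (SetIndexed.hasLargePairs_rectangles hN (SetIndexed.rectanglesIn_subset_rectangles b)
        hdown hb (Or.inr ⟨b, fun i => (hb i).le, le_rfl, rfl⟩) U₀)
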